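/- **Setting.** Let $n\ge 1$ workers hold datasets $\mathcal D_i=(x_{i,1},\dots,x_{i,m})$, and let $\mathcal H\subseteq[n]$, $|\mathcal H|=n-f$, be the set of honest workers, where $n\ge(2+\eta)f$ for a constant $\eta>0$. For $\theta\in\mathbb R^d$ let $\mathcal L_i(\theta)=\frac1m\sum_j\ell(\theta;x_{i,j})$, $\mathcal L_{\mathcal H}=\frac1{n-f}\sum_{i\in\mathcal H}\mathcal L_i$ and $\mathcal L_\star=\inf_\theta\mathcal L_{\mathcal H}(\theta)$, where $\ell(\cdot;x)$ is differentiable for every data point $x$ of an honest worker. Assume that * (bounded heterogeneity) $\frac1{n-f}\sum_{i\in\mathcal H}\langle v,\nabla\mathcal L_i(\theta)-\nabla\mathcal L_{\mathcal H}(\theta)\rangle^2\le G_{\mathrm{cov}}^2$ for all $\theta$ and all $\|v\|\le1$, where $G_{\mathrm{cov}}>0$; * (bounded variance) $\frac1m\sum_j\|\nabla\ell(\theta;x_{i,j})-\nabla\mathcal L_i(\theta)\|^2\le\sigma^2$ for all $\theta$ and all $i\in\mathcal H$, where $\sigma>0$; * for some $L,\mu>0$, $\mathcal L_{\mathcal H}$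 is $L$-smooth and $\mu$-strongly convex: $\frac\mu2\|\theta'-\theta\|^2\le\mathcal L_{\mathcal H}(\theta')-\mathcal L_{\mathcal H}(\theta)-\langle\nabla\mathcal L_{\mathcal H}(\theta),\theta'-\theta\rangle\le\frac L2\|\theta'-\theta\|^2$ for all $\theta,\theta'$. **Algorithm** (CafCor with the coordinate-wise trimmed mean, $T$ steps). Let $C,\varepsilon>0$, $\delta\in(0,1)$, $1\le b\le m$, $\theta_0\in\mathbb R^d$, and $$s_T=\frac{32\,C^2\,T\log(1/\delta)}{\varepsilon^2(n-f)},\qquad \gamma_t=\frac{10}{\mu\,(t+240L/\mu)},\qquad \beta_t=1-24L\gamma_t .$$ Start from $m_0^{(i)}=0$. For $t=0,\dots,T-1$, the server receives $m_t^{(i)}$ from every $i\in\mathcal H$ and an arbitrary vector from every $i\notin\mathcal H$, computes the coordinate-wise trimmed mean $R_t$ of the $n$ vectors (in each coordinate, discard the $f$ smallest and the $f$ largest values and average the other $n-2f$), and sets $\theta_{t+1}=\theta_t-\gamma_tR_t$. Then every $i\in\mathcal H$ sets $m_{t+1}^{(i)}=\beta_tm_t^{(i)}+(1-\beta_t)\tilde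 g_{t+1}^{(i)}$ with $$\tilde g_{t}^{(i)}=\frac1b\sum_{j\in S_t^{(i)}}\nabla\ell(\theta_t;x_{i,j})+\sum_{j\ne i}v_t^{(ij)}+\bar v_t^{(i)},\qquad v_t^{(ij)}=-v_t^{(ji)}\sim\mathcal N(0,s_TI_d),\quad \bar v_t^{(i)}\sim\mathcal N(0,s_TI_d),$$ where $S_t^{(i)}$ is a uniformly random $b$-subset of $[m]$ and all these draws are independent, except for $v^{(ij)}_t=-v^{(ji)}_t$. The messages of the malicious workers at step $t$ may be any measurable function of their private randomness (independent of the above) and of everything drawn up to and including step $t$. The output is $\theta_T$. The algorithm is $(f,\varrho)$-robust if, for every such behaviour of the malicious workers, $\mathcal L_{\mathcal H}(\theta_T)-\mathcal L_\star$ is integrable and $\mathbb E[\mathcal L_{\mathcal H}(\theta_T)-\mathcal L_\star]\le\varrho$. **Theorem.** For every $\eta>0$ there is a constant $K>0$, depending only on $\eta$, such that, in every setting as above, for all sufficiently large $T$ the algorithm is $(f,\varrho)$-robust with $$\varrho=K\left(\frac{L}{\mu^2}\left[\frac fn\cdot\frac{C^2d\log(1/\delta)}{\varepsilon^2}+\frac{C^2d\log(1/\delta)}{n^2\varepsilon^2}\right]+\frac1\mu\cdot\frac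 fn\,d\,G_{\mathrm{cov}}^2\right).$$ How large $T$ must be does not depend on the behaviour of the malicious workers. (If every $\|\nabla\ell(\theta;x)\|\le C$, clipping gradients at level $C$ would not change the algorithm.) -/

import Mathlib

open MeasureTheory ProbabilityTheory

noncomputable section

namespace CafCor

/-- Parameter space `ℝ^d` with the Euclidean norm. -/
abbrev E (d : ℕ) : Type := EuclideanSpace ℝ (Fin d)

/-! ### Losses and assumptions -/

section Losses

variable {X : Type*} {n m d : ℕ}

/-- Gradient of the pointwise loss `ℓ(·; x)` at `θ`. -/
def pointGrad (ℓ : E d → X → ℝ) (x : X) (θ : E d) : E d :=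
  gradient (fun θ' => ℓ θ' x) θ

/-- Empirical loss `L_i` of worker `i`, whose dataset is `D i 0, …, D i (m - 1)`. -/
def localLoss (ℓ : E d → X → ℝ) (D : Fin n → Fin m → X) (i : Fin n) (θ : E d) : ℝ :=
  (m : ℝ)⁻¹ * ∑ j, ℓ θ (D i j)

/-- Global honest loss `L_H`. -/
def honestLoss (ℓ : E d → X → ℝ) (D : Fin n → Fin m → X) (H : Finset (Fin n)) (θ : E d) : ℝ :=
  (H.card : ℝ)⁻¹ * ∑ i ∈ H, localLoss ℓ D i θ

/-- `L`-smoothness. -/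
def IsSmooth (L : ℝ) (F : E d → ℝ) : Prop :=
  ∀ θ θ' : E d, F θ' - F θ - inner ℝ (gradient F θ) (θ' - θ) ≤ L / 2 * ‖θ' - θ‖ ^ 2

/-- `μ`-strong convexity. -/
def IsStronglyConvex (μ : ℝ) (F : E d → ℝ) : Prop :=
  ∀ θ θ' : E d, μ / 2 * ‖θ' - θ‖ ^ 2 ≤ F θ' - F θ - inner ℝ (gradient F θ) (θ' - θ)

/-- Bounded heterogeneity: in every direction, the variance of the honest workers' gradients is at
most `G ^ 2`. -/
def BoundedHeterogeneity (ℓ : E d → X → ℝ) (D : Fin n → Fin m → X) (H : Finset (Fin n))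
    (G : ℝ) : Prop :=
  ∀ θ v : E d, ‖v‖ ≤ 1 →
    (H.card : ℝ)⁻¹ * ∑ i ∈ H,
      (inner ℝ v (gradient (localLoss ℓ D i) θ - gradient (honestLoss ℓ D H) θ)) ^ 2 ≤ G ^ 2

/-- Bounded variance of the pointwise gradients of every honest worker. -/
def BoundedVariance (ℓ : E d → X → ℝ) (D : Fin n → Fin m → X) (H : Finset (Fin n))
    (σ : ℝ) : Prop :=
  ∀ i ∈ H, ∀ θ : E d,
    (m : ℝ)⁻¹ * ∑ j, ‖pointGrad ℓ (D i j) θ - gradient (localLoss ℓ D i) θ‖ ^ 2 ≤ σ ^ 2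

end Losses

/-! ### Coordinate-wise trimmed mean -/

/-- Trimmed mean of `n` reals: sort them, discard the `f` smallest and the `f` largest ones, and
average the remaining `n - 2 f`. -/
def trimmedMean {n : ℕ} (f : ℕ) (x : Fin n → ℝ) : ℝ :=
  ((n : ℝ) - 2 * f)⁻¹ *
    ∑ r ∈ Finset.univ.filter (fun r : Fin n => f ≤ (r : ℕ) ∧ (r : ℕ) + f < n),
      x (Tuple.sort x r)

/-- Coordinate-wise trimmed mean. -/
def cwtm {n d : ℕ} (f : ℕ) (x : Fin n → E d) : E d :=
  WithLp.toLp 2 fun k => trimmedMean f fun i => x i k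

/-! ### Randomness of the honest workers -/

/-- The randomness drawn in one step: the mini-batches `S i`, the pairwise shared Gaussian vectors
`w i j` (only the entries with `i < j` are used), and the independent Gaussian vectors `u i`. -/
abbrev Round (n m d : ℕ) : Type :=
  (Fin n → Finset (Fin m)) × (Fin n → Fin n → E d) × (Fin n → E d)

/-- A uniformly random subset of `b` of the `m` data points (sampling without replacement). -/
def batchLaw (m b : ℕ) : Measure (Finset (Fin m)) :=
  uniformOn ((Finset.univ : Finset (Fin m)).powersetCard b : Set (Finset (Fin m)))

/-- The Gaussian law `N(0, s I_d)`, where `s ≥ 0` is the variance of a coordinate. -/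
def gaussianLaw (d : ℕ) (s : ℝ) : Measure (E d) :=
  (stdGaussian (E d)).map fun z => √s • z

/-- Law of the randomness of one step; all its components are independent. -/
def roundLaw (n m d b : ℕ) (sCor sInd : ℝ) : Measure (Round n m d) :=
  (Measure.pi fun _ : Fin n => batchLaw m b).prod
    ((Measure.pi fun _ : Fin n => Measure.pi fun _ : Fin n => gaussianLaw d sCor).prod
      (Measure.pi fun _ : Fin n => gaussianLaw d sInd))

/-- The correlated noise `v i j = - v j i` between workers `i` and `j`. -/
def corNoise {n m d : ℕ} (ρ : Round n m d) (i j : Fin n) : E d :=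
  if i < j then ρ.2.1 i j else -ρ.2.1 j i

/-- The total noise `∑_{j ≠ i} v i j + u i` that worker `i` adds to its gradient. -/
def noise {n m d : ℕ} (ρ : Round n m d) (i : Fin n) : E d :=
  ∑ j ∈ Finset.univ.erase i, corNoise ρ i j + ρ.2.2 i

/-! ### The algorithm -/

/-- A strategy of the malicious workers, with private randomness in `A`. Their messages at step `t`
are an arbitrary measurable function of the private randomness and of everything that the workers
have drawn up to and including step `t` (hence of all models and all honest messages so far). -/
structure Adversary (n m d : ℕ) (A : Type) [MeasurableSpace A] where
  /-- `msg t s i` is the message of worker `i` at step `t`, used only if `i` is malicious. -/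
  msg : ∀ t : ℕ, A × (Finset.Iic t → Round n m d) → Fin n → E d
  measurable_msg : ∀ t, Measurable (msg t)

/-- Parameters of the algorithm. -/
structure Params (n d : ℕ) where
  /-- aggregation rule used by the server -/
  agg : (Fin n → E d) → E d
  /-- mini-batch size -/
  batchSize : ℕ
  /-- variance of the correlated noise -/
  varCor : ℝ
  /-- variance of the independent noise -/
  varInd : ℝ
  /-- learning rates -/
  lr : ℕ → ℝ
  /-- momentum coefficients -/
  mom : ℕ → ℝ
  /-- initial model -/
  init : E d

section Algorithm

variable {X : Type*} {n m d : ℕ}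

/-- Mini-batch gradient of worker `i` on the batch `S`. -/
def batchGrad (ℓ : E d → X → ℝ) (D : Fin n → Fin m → X) (i : Fin n) (S : Finset (Fin m))
    (θ : E d) : E d :=
  (S.card : ℝ)⁻¹ • ∑ j ∈ S, pointGrad ℓ (D i j) θ

/-- Noisy gradient of the honest worker `i`. -/
def noisyGrad (ℓ : E d → X → ℝ) (D : Fin n → Fin m → X) (ρ : Round n m d) (i : Fin n)
    (θ : E d) : E d :=
  batchGrad ℓ D i (ρ.1 i) θ + noise ρ i

/-- The pair `(θ_t, (m_t^(i))_i)` of the current model and the honest momentums.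
At `t = 0` all momentums are `0`. Then `θ_{t+1} = θ_t - γ_t R_t`, where `R_t` aggregates the
momentums `m_t^(i)` of the honest workers and the messages of the malicious ones, and
`m_{t+1}^(i) = β_t m_t^(i) + (1 - β_t) g_{t+1}^(i)`, where `g_{t+1}^(i)` is the noisy mini-batch
gradient at `θ_{t+1}`. -/
def state (ℓ : E d → X → ℝ) (D : Fin n → Fin m → X) (H : Finset (Fin n)) (p : Params n d)
    {A : Type} [MeasurableSpace A] (adv : Adversary n m d A) (a : A) (ω : ℕ → Round n m d) :
    ℕ → E d × (Fin n → E d)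
  | 0 => (p.init, 0)
  | t + 1 =>
    let s := state ℓ D H p adv a ω t
    let R : E d := p.agg fun i =>
      if i ∈ H then s.2 i else adv.msg t (a, fun k => ω k) i
    let θ : E d := s.1 - p.lr t • R
    (θ, fun i => p.mom t • s.2 i + (1 - p.mom t) • noisyGrad ℓ D (ω (t + 1)) i θ)

/-- Law of all the randomness: the private randomness of the malicious workers and the independent
steps of the honest workers. -/
def runLaw (m : ℕ) (p : Params n d) {A : Type} [MeasurableSpace A] (ν : Measure A) :
    Measure (A × (ℕ → Round n m d)) :=
  ν.prod (Measure.infinitePi fun _ : ℕ => roundLaw n m d p.batchSize p.varCor p.varInd)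

/-- Robustness against the malicious workers outside `H`: whatever they do, the expected
suboptimality of the output `θ_T` for the honest loss exists and is at most `ϱ`. -/
def IsRobust (ℓ : E d → X → ℝ) (D : Fin n → Fin m → X) (H : Finset (Fin n)) (p : Params n d)
    (T : ℕ) (ϱ : ℝ) : Prop :=
  ∀ (A : Type) [MeasurableSpace A] (ν : Measure A) [IsProbabilityMeasure ν]
    (adv : Adversary n m d A),
    Integrable (fun s : A × (ℕ → Round n m d) =>
      honestLoss ℓ D H (state ℓ D H p adv s.1 s.2 T).1 - ⨅ θ, honestLoss ℓ D H θ)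
      (runLaw m p ν) ∧
    ∫ s : A × (ℕ → Round n m d),
      (honestLoss ℓ D H (state ℓ D H p adv s.1 s.2 T).1 - ⨅ θ, honestLoss ℓ D H θ)
      ∂(runLaw m p ν) ≤ ϱ

end Algorithm

/-- The noise variance `32 C² T log(1/δ) / (ε² (n - f))`. -/
def noiseVar (n f T : ℕ) (C ε δ : ℝ) : ℝ :=
  32 * C ^ 2 * T * Real.log (1 / δ) / (ε ^ 2 * ((n : ℝ) - f))

/-- The learning rate `γ_t = 10 / (μ (t + 240 L / μ))`. -/
def stepSize (L μ : ℝ) (t : ℕ) : ℝ := 10 / (μ * (t + 240 * (L / μ)))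

/-- CafCor run for `T` steps, with the coordinate-wise trimmed mean as aggregation rule. -/
def cwtmParams (n d f b T : ℕ) (C ε δ L μ : ℝ) (θ₀ : E d) : Params n d where
  agg := cwtm f
  batchSize := b
  varCor := noiseVar n f T C ε δ
  varInd := noiseVar n f T C ε δ
  lr := stepSize L μ
  mom t := 1 - 24 * L * stepSize L μ t
  init := θ₀

end CafCor

end

open MeasureTheory ProbabilityTheory

noncomputable section

namespace CafCor

/-! ### Smooth strongly convex functions -/

section Optimization

variable {d : ℕ} {F : E d → ℝ} {L μ : ℝ}

/-! Write `F` for the honest loss and `M_t` for the average of the honest momentums. Two quantities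
are followed along the run: the spread of the honest momentums around `M_t`, and the Lyapunov
function `F θ_t - inf F + ‖M_t - ∇F θ_t‖² / L`. Whatever the malicious workers send, the trimmed
mean is within squared distance `κ * spread` of `M_t`, with `κ` of order `f / n`
(`norm_cwtm_sub_honestMean_sq_le`, `trimCoeff_le`). Descent along it therefore contracts the
Lyapunov function by `1 - μ γ_t`, up to `γ_t κ * spread` and the variance of fresh noise
(`lyapunov_step`).

Correlated noise enters the two quantities differently. A single worker carries `n` Gaussian
vectors, of total variance `n s_T d`; in the honest average the noise shared by honest workers
cancels, which leaves variance `(f + 1) / (n - f) * s_T d` (`integral_norm_sq_sum_noise`). The large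
variance acts only through the spread and so is multiplied by `κ`, while the small one acts
directly.

Malicious messages need no model: those of step `t` are fixed before round `t + 1` is drawn, so that
round can be averaged first, with `θ_{t+1}` frozen (`lintegral_resample`, `nextModel_update`). The
resulting scalar recursions are solved in `le_of_momentum_recursion` and `le_of_descent_recursion`:
up to `O(1 / t)`, the spread is at most `d G²` and the Lyapunov function at most `κ d G² / μ`. At `t
= T` the decay `1 / T` compensates `s_T`, which is proportional to `T`, and leaves the privacy terms
of the rate; the contributions of the initial point and of `σ` vanish, so they are absorbed for
large `T`. -/

/-- Smoothness is only an upper bound here, so convexity is needed too. At `y - g / L`, with `g` the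
difference of gradients, the upper model based at `y` must lie above the lower model based at `x`.
-/
theorem norm_gradient_sub_le (hL : 0 < L) (hμ : 0 < μ) (hs : IsSmooth L F)
    (hc : IsStronglyConvex μ F) (x y : E d) :
    ‖gradient F y - gradient F x‖ ≤ L * ‖y - x‖ := by
  set g := gradient F y - gradient F x with hg
  have h1 := hs y (y - (1 / L) • g)
  have h2 := hc x (y - (1 / L) • g)
  have h3 := hs x y
  have e1 : y - (1 / L) • g - y = -((1 / L) • g) := by abel
  have e2 : y - (1 / L) • g - x = (y - x) - (1 / L) • g := by abel
  rw [e1, norm_neg, norm_smul, inner_neg_right, real_inner_smul_right] at h1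
  rw [e2, inner_sub_right, real_inner_smul_right] at h2
  have h4 : 0 ≤ μ / 2 * ‖(y - x) - (1 / L) • g‖ ^ 2 := by positivity
  have h5 : inner ℝ (gradient F y) g - inner ℝ (gradient F x) g = ‖g‖ ^ 2 := by
    rw [← inner_sub_left, ← hg, real_inner_self_eq_norm_sq]
  rw [Real.norm_of_nonneg (by positivity), mul_pow] at h1
  have h6 : L / 2 * ((1 / L) ^ 2 * ‖g‖ ^ 2) = (1 / L) * ‖g‖ ^ 2 / 2 := by field_simp
  have h7 : (1 / L) * inner ℝ (gradient F y) g - (1 / L) * inner ℝ (gradient F x) g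
      = (1 / L) * ‖g‖ ^ 2 := by rw [← mul_sub, h5]
  have h8 : (1 / L) * ‖g‖ ^ 2 ≤ L * ‖y - x‖ ^ 2 := by linarith
  rw [one_div, inv_mul_le_iff₀ hL] at h8
  refine le_of_sq_le_sq ?_ (by positivity)
  calc ‖g‖ ^ 2 ≤ L * (L * ‖y - x‖ ^ 2) := h8
    _ = (L * ‖y - x‖) ^ 2 := by ring

/-- Minimising the quadratic lower model at `x` over all `y` gives this. It needs no minimiser of
`F`, and yields both boundedness below and the Polyak–Łojasiewicz inequality. -/
theorem sub_le_norm_gradient_sq (hμ : 0 < μ) (hc : IsStronglyConvex μ F) (x y : E d) :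
    2 * μ * (F x - F y) ≤ ‖gradient F x‖ ^ 2 := by
  have h := hc x y
  have h1 := abs_real_inner_le_norm (gradient F x) (y - x)
  have h2 := neg_le_of_abs_le h1
  nlinarith [sq_nonneg (‖gradient F x‖ - μ * ‖y - x‖)]

theorem bddBelow_of_isStronglyConvex (hμ : 0 < μ) (hc : IsStronglyConvex μ F) :
    BddBelow (Set.range F) := by
  refine ⟨F 0 - ‖gradient F 0‖ ^ 2 / (2 * μ), ?_⟩
  rintro _ ⟨y, rfl⟩
  have h := sub_le_norm_gradient_sq hμ hc 0 y
  have : F 0 - F y ≤ ‖gradient F 0‖ ^ 2 / (2 * μ) := by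
    rw [le_div_iff₀ (by positivity)]; linarith
  linarith

theorem sub_iInf_nonneg (hμ : 0 < μ) (hc : IsStronglyConvex μ F) (x : E d) :
    0 ≤ F x - ⨅ y, F y :=
  sub_nonneg.2 (ciInf_le (bddBelow_of_isStronglyConvex hμ hc) x)

/-- The Polyak–Łojasiewicz inequality. -/
theorem sub_iInf_le_norm_gradient_sq (hμ : 0 < μ) (hc : IsStronglyConvex μ F) (x : E d) :
    2 * μ * (F x - ⨅ y, F y) ≤ ‖gradient F x‖ ^ 2 := by
  have h : F x - ‖gradient F x‖ ^ 2 / (2 * μ) ≤ ⨅ y, F y := by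
    refine le_ciInf fun y => ?_
    have h := sub_le_norm_gradient_sq hμ hc x y
    have : F x - F y ≤ ‖gradient F x‖ ^ 2 / (2 * μ) := by
      rw [le_div_iff₀ (by positivity)]; linarith
    linarith
  have h2 : F x - ⨅ y, F y ≤ ‖gradient F x‖ ^ 2 / (2 * μ) := by linarith
  rw [le_div_iff₀ (by positivity)] at h2
  linarith

theorem isStronglyConvex_le_isSmooth [Nontrivial (E d)] (hs : IsSmooth L F)
    (hc : IsStronglyConvex μ F) : μ ≤ L := by
  obtain ⟨v, hv⟩ := exists_ne (0 : E d)
  have h := (hc 0 v).trans (hs 0 v)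
  have : 0 < ‖v - 0‖ ^ 2 := by rw [sub_zero]; positivity
  have := le_of_mul_le_mul_right h this
  linarith

theorem norm_add_sq_le_two_mul {V : Type*} [SeminormedAddCommGroup V] (a b : V) :
    ‖a + b‖ ^ 2 ≤ 2 * ‖a‖ ^ 2 + 2 * ‖b‖ ^ 2 := by
  have h := norm_add_le a b
  nlinarith [norm_nonneg (a + b), sq_nonneg (‖a‖ - ‖b‖)]

/-- The Lyapunov function: suboptimality plus the squared error of the gradient estimate `M`. -/
def lyapunov (L : ℝ) (F : E d → ℝ) (θ M : E d) : ℝ :=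
  F θ - (⨅ y, F y) + 1 / L * ‖M - gradient F θ‖ ^ 2

theorem lyapunov_nonneg (hL : 0 < L) (hμ : 0 < μ) (hc : IsStronglyConvex μ F) (θ M : E d) :
    0 ≤ lyapunov L F θ M :=
  add_nonneg (sub_iInf_nonneg hμ hc θ) (by positivity)

/-- Young's inequality with weight `1 - β = 24 x`. -/
theorem one_sub_sq_mul_add_sq_le {x e r : ℝ} (hx : 0 ≤ x) (hx1 : 24 * x ≤ 1) :
    (1 - 24 * x) ^ 2 * (e + x * r) ^ 2 ≤ (1 - 24 * x) * e ^ 2 + x / 24 * r ^ 2 := by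
  -- The cross term satisfies `2 x e r ≤ 24 x e² + (x / 24) r²`; then `(1 - 24 x)(1 + 24 x) ≤ 1`
  -- removes the growth factor.
  have h3 : (e + x * r) ^ 2 ≤ (1 + 24 * x) * e ^ 2 + (x ^ 2 + x / 24) * r ^ 2 := by
    nlinarith [mul_nonneg hx (sq_nonneg (24 * e - r))]
  have hβ0 : 0 ≤ 1 - 24 * x := by linarith
  have h5 : (1 - 24 * x) * (1 + 24 * x) ≤ 1 := by nlinarith
  have h6 : (1 - 24 * x) ^ 2 * (1 + 24 * x) ≤ 1 - 24 * x := by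
    have := mul_le_mul_of_nonneg_left h5 hβ0
    linarith
  have h7 : (1 - 24 * x) ^ 2 * (x ^ 2 + x / 24) ≤ x / 24 := by
    have h8 : (1 - 24 * x) ^ 2 * (1 + 24 * x) ≤ 1 := by linarith
    have := mul_le_mul_of_nonneg_left h8 (div_nonneg hx (by norm_num : (0 : ℝ) ≤ 24))
    linarith
  calc (1 - 24 * x) ^ 2 * (e + x * r) ^ 2
      ≤ (1 - 24 * x) ^ 2 * ((1 + 24 * x) * e ^ 2 + (x ^ 2 + x / 24) * r ^ 2) := by gcongr
    _ = ((1 - 24 * x) ^ 2 * (1 + 24 * x)) * e ^ 2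
        + ((1 - 24 * x) ^ 2 * (x ^ 2 + x / 24)) * r ^ 2 := by ring
    _ ≤ (1 - 24 * x) * e ^ 2 + x / 24 * r ^ 2 := by gcongr

/-- One step of the descent along an estimate `R` of the averaged momentum `M`. -/
theorem lyapunov_step (hL : 0 < L) (hμ : 0 < μ) (hμL : μ ≤ L) (hs : IsSmooth L F)
    (hc : IsStronglyConvex μ F) {γ : ℝ} (hγ : 0 < γ) (hγL : 24 * L * γ ≤ 1) (θ M R : E d) :
    F (θ - γ • R) - (⨅ y, F y)
        + 1 / L * ((1 - 24 * L * γ) ^ 2 * ‖M - gradient F (θ - γ • R)‖ ^ 2)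
      ≤ (1 - μ * γ) * lyapunov L F θ M + γ * ‖R - M‖ ^ 2 := by
  unfold lyapunov
  set g := gradient F θ with hg
  set g' := gradient F (θ - γ • R) with hg'
  have hsm := hs θ (θ - γ • R)
  have e1 : θ - γ • R - θ = -(γ • R) := by abel
  rw [e1, norm_neg, norm_smul, inner_neg_right, real_inner_smul_right,
    Real.norm_of_nonneg hγ.le, mul_pow] at hsm
  have hPL := sub_iInf_le_norm_gradient_sq hμ hc θ
  have hlip := norm_gradient_sub_le hL hμ hs hc θ (θ - γ • R)
  rw [e1, norm_neg, norm_smul, Real.norm_of_nonneg hγ.le] at hlip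
  -- Polarisation turns `-γ ⟪g, R⟫` into `γ / 2 * (‖R - g‖² - ‖R‖² - ‖g‖²)`. The term in `‖g‖²`
  -- gives the contraction, and the one in `‖R‖²` pays for the quadratic term of smoothness and for
  -- the drift of the gradient.
  have hpol : ‖R - g‖ ^ 2 = ‖R‖ ^ 2 - 2 * inner ℝ g R + ‖g‖ ^ 2 := by
    rw [norm_sub_sq_real, real_inner_comm]
  have herr : ‖R - g‖ ^ 2 ≤ 2 * ‖M - g‖ ^ 2 + 2 * ‖R - M‖ ^ 2 := by
    have := norm_add_sq_le_two_mul (M - g) (R - M)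
    rwa [show M - g + (R - M) = R - g by abel] at this
  set r := ‖R‖ with hr
  set e := ‖M - g‖ with he
  set β := 1 - 24 * L * γ with hβ
  have hβ0 : 0 ≤ β := by linarith
  have hβ1 : β ≤ 1 := by have : 0 < L * γ := by positivity
                         linarith
  have htri : ‖M - g'‖ ≤ e + L * (γ * r) := by
    have h := norm_sub_le (M - g) (g' - g)
    rw [show M - g - (g' - g) = M - g' by abel] at h
    linarith
  have hr0 : 0 ≤ r := norm_nonneg _
  have he0 : 0 ≤ e := norm_nonneg _
  have hx : 0 < L * γ := by positivity
  have hY : β ^ 2 * ‖M - g'‖ ^ 2 ≤ β * e ^ 2 + L * γ / 24 * r ^ 2 := by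
    have hβx : β = 1 - 24 * (L * γ) := by rw [hβ]; ring
    have h := one_sub_sq_mul_add_sq_le (e := e) (r := r) hx.le (by linarith : 24 * (L * γ) ≤ 1)
    rw [← hβx, mul_assoc L γ r] at h
    exact (mul_le_mul_of_nonneg_left (pow_le_pow_left₀ (norm_nonneg _) htri 2)
      (sq_nonneg β)).trans h
  -- The momentum releases `24 γ e²`, which covers both the error `γ e²` of the descent direction
  -- and the loss `μ γ e² / L ≤ γ e²` from contracting at rate `μ γ` only.
  have hY' : 1 / L * (β ^ 2 * ‖M - g'‖ ^ 2) ≤ 1 / L * e ^ 2 - 24 * γ * e ^ 2 + γ / 24 * r ^ 2 := by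
    calc 1 / L * (β ^ 2 * ‖M - g'‖ ^ 2) ≤ 1 / L * (β * e ^ 2 + L * γ / 24 * r ^ 2) := by gcongr
      _ = _ := by rw [hβ]; field_simp
  have hμe : μ * γ * (1 / L * e ^ 2) ≤ γ * e ^ 2 := by
    have : μ * (1 / L) ≤ 1 := by rw [mul_one_div, div_le_one hL]; exact hμL
    calc μ * γ * (1 / L * e ^ 2) = (μ * (1 / L)) * (γ * e ^ 2) := by ring
      _ ≤ 1 * (γ * e ^ 2) := by gcongr
      _ = _ := one_mul _
  have hquad : L / 2 * (γ ^ 2 * r ^ 2) ≤ γ / 48 * r ^ 2 := by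
    have : L / 2 * (γ ^ 2 * r ^ 2) = (24 * L * γ) * (γ / 48 * r ^ 2) := by ring
    rw [this]
    exact mul_le_of_le_one_left (by positivity) hγL
  have hmain : γ * (2 * inner ℝ g R) = γ * (r ^ 2 + ‖g‖ ^ 2 - ‖R - g‖ ^ 2) := by
    rw [hpol]; ring
  have herr' := mul_le_mul_of_nonneg_left herr hγ.le
  have hPL' := mul_le_mul_of_nonneg_left hPL hγ.le
  have : 0 ≤ γ * r ^ 2 := by positivity
  have : 0 ≤ γ * e ^ 2 := by positivity
  linarith

end Optimization

/-! ### The trimmed mean -/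

section TrimmedMean

open Finset

variable {n : ℕ}

/-- Average over the honest workers. -/
def honestMean {V : Type*} [AddCommGroup V] [Module ℝ V] (H : Finset (Fin n)) (x : Fin n → V) : V :=
  (H.card : ℝ)⁻¹ • ∑ i ∈ H, x i

/-- Values kept by the trimming that lie outside `H` are dominated in square by trimmed values
in `H`. -/
theorem sum_sq_kept_le {H lo hi I : Finset (Fin n)} {y : Fin n → ℝ}
    (hlo : ∀ a ∈ lo, ∀ i ∈ I, y a ≤ y i) (hhi : ∀ b ∈ hi, ∀ i ∈ I, y i ≤ y b)
    (clo : (I \ H).card ≤ (H ∩ lo).card) (chi : (I \ H).card ≤ (H ∩ hi).card) :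
    ∑ i ∈ I \ H, y i ^ 2 ≤ ∑ i ∈ H ∩ lo, y i ^ 2 + ∑ i ∈ H ∩ hi, y i ^ 2 := by
  rcases (I \ H).eq_empty_or_nonempty with h | h
  · rw [h, sum_empty]; positivity
  obtain ⟨i₀, hi₀, hmax⟩ := exists_max_image (I \ H) (fun i => y i ^ 2) h
  have hI := (mem_sdiff.1 hi₀).1
  have hle : ∑ i ∈ I \ H, y i ^ 2 ≤ (I \ H).card * y i₀ ^ 2 := by
    rw [← nsmul_eq_mul]; exact sum_le_card_nsmul _ _ _ hmax
  have key : ∀ S : Finset (Fin n), (I \ H).card ≤ S.card → (∀ a ∈ S, y i₀ ^ 2 ≤ y a ^ 2) →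
      ∑ i ∈ I \ H, y i ^ 2 ≤ ∑ i ∈ S, y i ^ 2 := fun S hS h => by
    calc _ ≤ ((I \ H).card : ℝ) * y i₀ ^ 2 := hle
      _ ≤ S.card * y i₀ ^ 2 := by gcongr
      _ ≤ _ := by rw [← nsmul_eq_mul]; exact card_nsmul_le_sum _ _ _ h
  have p1 : 0 ≤ ∑ i ∈ H ∩ lo, y i ^ 2 := by positivity
  have p2 : 0 ≤ ∑ i ∈ H ∩ hi, y i ^ 2 := by positivity
  -- If the largest kept value is nonnegative, the values trimmed above dominate it in square;
  -- otherwise those trimmed below do.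
  rcases le_total 0 (y i₀) with h0 | h0
  · refine (key (H ∩ hi) chi fun b hb => ?_).trans (by linarith)
    exact pow_le_pow_left₀ h0 (hhi b (mem_inter.1 hb).2 _ hI) 2
  · refine (key (H ∩ lo) clo fun a ha => ?_).trans (by linarith)
    have := hlo a (mem_inter.1 ha).2 _ hI
    nlinarith

/-- Deviations from the honest mean sum to zero over `H`, so their sum over the kept set `I` is the
sum over `I \ H` minus that over `H \ I`. These sets have `k ≤ f` and `f + k` elements, and each has
sum of squares at most the total `Q` over `H`. Cauchy–Schwarz gives `2 k Q + 2 (f + k) Q ≤ 6 f Q`.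
-/
theorem sq_trimmedMean_sub_le {f : ℕ} (hf : 2 * f < n) {H : Finset (Fin n)} (hH : H.card = n - f)
    (x : Fin n → ℝ) :
    (trimmedMean f x - honestMean H x) ^ 2
      ≤ 6 * f * ((n : ℝ) - f) / ((n : ℝ) - 2 * f) ^ 2 *
        ((H.card : ℝ)⁻¹ * ∑ i ∈ H, (x i - honestMean H x) ^ 2) := by
  set c := honestMean H x with hc
  set τ := Tuple.sort x with hτ
  have hmono : Monotone (x ∘ τ) := Tuple.monotone_sort x
  set I := (univ.filter fun r : Fin n => f ≤ (r : ℕ) ∧ (r : ℕ) + f < n).map τ.toEmbedding with hI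
  set lo := (univ.filter fun r : Fin n => (r : ℕ) < f).map τ.toEmbedding with hlo
  set hi := (univ.filter fun r : Fin n => n ≤ (r : ℕ) + f).map τ.toEmbedding with hhi
  have hfn : (2 : ℝ) * f < n := by exact_mod_cast hf
  have hHc : (H.card : ℝ) = n - f := by rw [hH, Nat.cast_sub (by omega)]
  have cI : I.card = n - 2 * f := by
    rw [hI, card_map]
    have : (univ.filter fun r : Fin n => f ≤ (r : ℕ) ∧ (r : ℕ) + f < n).card
        = (Ico f (n - f)).card := by
      refine card_bij (fun r _ => (r : ℕ)) ?_ ?_ ?_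
      · intro r hr; simp at hr ⊢; omega
      · intro a _ b _ h; exact Fin.ext h
      · intro k hk; simp at hk; exact ⟨⟨k, by omega⟩, by simp; omega, rfl⟩
    rw [this, Nat.card_Ico]; omega
  have clo : lo.card = f := by
    rw [hlo, card_map]
    have : (univ.filter fun r : Fin n => (r : ℕ) < f).card = (range f).card := by
      refine card_bij (fun r _ => (r : ℕ)) ?_ ?_ ?_
      · intro r hr; simpa using hr
      · intro a _ b _ h; exact Fin.ext h
      · intro k hk; simp at hk; exact ⟨⟨k, by omega⟩, by simpa using hk, rfl⟩
    rw [this, card_range]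
  have chi : hi.card = f := by
    rw [hhi, card_map]
    have : (univ.filter fun r : Fin n => n ≤ (r : ℕ) + f).card = (Ico (n - f) n).card := by
      refine card_bij (fun r _ => (r : ℕ)) ?_ ?_ ?_
      · intro r hr; simp at hr ⊢; omega
      · intro a _ b _ h; exact Fin.ext h
      · intro k hk; simp at hk; exact ⟨⟨k, by omega⟩, by simp; omega, rfl⟩
    rw [this, Nat.card_Ico]; omega
  have dIlo : Disjoint I lo := by
    rw [hI, hlo, disjoint_map, disjoint_filter]; intro r _ h; omega
  have dIhi : Disjoint I hi := by
    rw [hI, hhi, disjoint_map, disjoint_filter]; intro r _ h; omega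
  have dlohi : Disjoint lo hi := by
    rw [hlo, hhi, disjoint_map, disjoint_filter]; intro r _ h; omega
  have lelo : ∀ a ∈ lo, ∀ i ∈ I, x a - c ≤ x i - c := by
    intro a ha i hi'
    rw [hlo, mem_map] at ha; rw [hI, mem_map] at hi'
    obtain ⟨r, hr, rfl⟩ := ha; obtain ⟨r', hr', rfl⟩ := hi'
    simp only [mem_filter] at hr hr'
    have : r ≤ r' := by rw [Fin.le_def]; omega
    exact sub_le_sub_right (hmono this) c
  have lehi : ∀ b ∈ hi, ∀ i ∈ I, x i - c ≤ x b - c := by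
    intro a ha i hi'
    rw [hhi, mem_map] at ha; rw [hI, mem_map] at hi'
    obtain ⟨r, hr, rfl⟩ := ha; obtain ⟨r', hr', rfl⟩ := hi'
    simp only [mem_filter] at hr hr'
    have : r' ≤ r := by rw [Fin.le_def]; omega
    exact sub_le_sub_right (hmono this) c
  -- cardinalities
  have cHc : (univ \ H).card = f := by
    rw [card_sdiff_of_subset (subset_univ _), card_univ, Fintype.card_fin]; omega
  -- The `f` malicious indices are shared between `I` and `S`; since `S` has `f` elements, each one
  -- in `I` leaves room for an honest one in `S`.
  have cutoff : ∀ S : Finset (Fin n), S.card = f → Disjoint I S →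
      (I \ H).card ≤ (H ∩ S).card := by
    intro S hS hd
    have h1 : (I \ H ∪ S \ H).card ≤ (univ \ H).card :=
      card_le_card (union_subset (sdiff_subset_sdiff (subset_univ _) le_rfl)
        (sdiff_subset_sdiff (subset_univ _) le_rfl))
    rw [card_union_of_disjoint (hd.mono sdiff_subset sdiff_subset), cHc] at h1
    have h2 := card_sdiff_add_card_inter S H
    rw [inter_comm] at h2
    omega
  have hsq := sum_sq_kept_le lelo lehi (cutoff lo clo dIlo) (cutoff hi chi dIhi)
  have hpart : (H ∩ lo) ∪ (H ∩ hi) ⊆ H \ I := by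
    intro i hi'
    rw [mem_sdiff]
    rcases mem_union.1 hi' with h | h <;> rw [mem_inter] at h
    · exact ⟨h.1, fun h' => disjoint_left.1 dIlo h' h.2⟩
    · exact ⟨h.1, fun h' => disjoint_left.1 dIhi h' h.2⟩
  have hsq2 : ∑ i ∈ I \ H, (x i - c) ^ 2 ≤ ∑ i ∈ H \ I, (x i - c) ^ 2 := by
    refine hsq.trans ?_
    rw [← sum_union (dlohi.mono inter_subset_right inter_subset_right)]
    exact sum_le_sum_of_subset_of_nonneg hpart fun _ _ _ => sq_nonneg _
  have hsq3 : ∑ i ∈ H \ I, (x i - c) ^ 2 ≤ ∑ i ∈ H, (x i - c) ^ 2 :=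
    sum_le_sum_of_subset_of_nonneg sdiff_subset fun _ _ _ => sq_nonneg _
  -- the sum of the deviations over `H` vanishes
  have hn : (0 : ℝ) < n - 2 * f := by linarith
  have hf0 : (0 : ℝ) ≤ f := Nat.cast_nonneg f
  have hzero : ∑ i ∈ H, (x i - c) = 0 := by
    rw [sum_sub_distrib, sum_const, nsmul_eq_mul, hc, honestMean, smul_eq_mul, hHc]
    have : (n : ℝ) - f ≠ 0 := by linarith
    field_simp; ring
  have hTM : trimmedMean f x - c = ((n : ℝ) - 2 * f)⁻¹ * ∑ i ∈ I, (x i - c) := by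
    rw [sum_sub_distrib, sum_const, cI, nsmul_eq_mul, Nat.cast_sub hf.le, trimmedMean, hI, sum_map]
    push_cast
    rw [mul_sub, inv_mul_cancel_left₀ hn.ne']
    rfl
  have hdiff : ∑ i ∈ I, (x i - c) = ∑ i ∈ I \ H, (x i - c) - ∑ i ∈ H \ I, (x i - c) := by
    have h1 := sum_sdiff_sub_sum_sdiff (s₁ := I) (s₂ := H) (f := fun i => x i - c)
    rw [hzero] at h1
    linarith
  set k := (I \ H).card with hk
  have hkf : k ≤ f := by
    rw [← cHc]; exact card_le_card (sdiff_subset_sdiff (subset_univ _) le_rfl)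
  have cHI : (H \ I).card = f + k := by
    have h1 := card_sdiff_add_card_inter I H
    have h2 := card_sdiff_add_card_inter H I
    rw [inter_comm] at h2
    omega
  set Q := ∑ i ∈ H, (x i - c) ^ 2 with hQ
  have hcs1 : (∑ i ∈ I \ H, (x i - c)) ^ 2 ≤ k * Q :=
    sq_sum_le_card_mul_sum_sq.trans (by gcongr; exact hsq2.trans hsq3)
  have hcs2 : (∑ i ∈ H \ I, (x i - c)) ^ 2 ≤ (f + k) * Q := by
    refine sq_sum_le_card_mul_sum_sq.trans ?_
    rw [cHI]; push_cast; gcongr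
  have hkf' : (k : ℝ) ≤ f := by exact_mod_cast hkf
  have hQ0 : 0 ≤ Q := by positivity
  have hsum : (∑ i ∈ I, (x i - c)) ^ 2 ≤ 6 * f * Q := by
    rw [hdiff]
    nlinarith [sq_nonneg (∑ i ∈ I \ H, (x i - c) + ∑ i ∈ H \ I, (x i - c)),
      mul_le_mul_of_nonneg_right hkf' hQ0]
  rw [hTM, mul_pow, hHc]
  have hnf : (n : ℝ) - f ≠ 0 := by linarith
  have : 6 * f * ((n : ℝ) - f) / ((n : ℝ) - 2 * f) ^ 2 * (((n : ℝ) - f)⁻¹ * Q)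
      = (((n : ℝ) - 2 * f)⁻¹) ^ 2 * (6 * f * Q) := by field_simp
  rw [this]
  gcongr

/-- Mean squared deviation of the honest vectors from their average. -/
def spread {d : ℕ} (H : Finset (Fin n)) (x : Fin n → E d) : ℝ :=
  (H.card : ℝ)⁻¹ * ∑ i ∈ H, ‖x i - honestMean H x‖ ^ 2

theorem spread_nonneg {d : ℕ} (H : Finset (Fin n)) (x : Fin n → E d) : 0 ≤ spread H x := by
  unfold spread; positivity

/-- The robustness coefficient of the trimmed mean. -/
def trimCoeff (n f : ℕ) : ℝ := 6 * f * ((n : ℝ) - f) / ((n : ℝ) - 2 * f) ^ 2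

theorem trimCoeff_nonneg {f : ℕ} (hf : 2 * f < n) : 0 ≤ trimCoeff n f := by
  have : (2 : ℝ) * f < n := by exact_mod_cast hf
  have h0 : (0 : ℝ) ≤ f := Nat.cast_nonneg f
  have : (0 : ℝ) ≤ n - f := by linarith
  unfold trimCoeff; positivity

theorem honestMean_apply {d : ℕ} (H : Finset (Fin n)) (x : Fin n → E d) (k : Fin d) :
    honestMean H x k = honestMean H fun i => x i k := by
  simp [honestMean]

/-- Squared distance and spread both split over coordinates, so the scalar bound carries over
without a factor `d`. -/
theorem norm_cwtm_sub_honestMean_sq_le {d f : ℕ} (hf : 2 * f < n) {H : Finset (Fin n)}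
    (hH : H.card = n - f) (x : Fin n → E d) :
    ‖cwtm f x - honestMean H x‖ ^ 2 ≤ trimCoeff n f * spread H x := by
  simp_rw [spread, EuclideanSpace.real_norm_sq_eq]
  rw [sum_comm, mul_sum, mul_sum]
  refine sum_le_sum fun k _ => ?_
  simp only [PiLp.sub_apply, honestMean_apply]
  exact sq_trimmedMean_sub_le hf hH fun i => x i k

theorem honestMean_congr {V : Type*} [AddCommGroup V] [Module ℝ V] {H : Finset (Fin n)}
    {x y : Fin n → V} (h : ∀ i ∈ H, x i = y i) : honestMean H x = honestMean H y := by
  unfold honestMean; rw [sum_congr rfl h]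

theorem spread_congr {d : ℕ} {H : Finset (Fin n)} {x y : Fin n → E d} (h : ∀ i ∈ H, x i = y i) :
    spread H x = spread H y := by
  unfold spread
  rw [honestMean_congr h]
  congr 1
  exact sum_congr rfl fun i hi => by rw [h i hi]

end TrimmedMean

/-! ### Second moments of random vectors -/

section Moments

theorem integral_comp_measurePreserving {α β V : Type*} [MeasurableSpace α] [MeasurableSpace β]
    [NormedAddCommGroup V] [NormedSpace ℝ V] {μ : Measure α} {ν : Measure β} {T : α → β}
    (hT : MeasurePreserving T μ ν) {g : β → V} (hg : AEStronglyMeasurable g ν) :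
    ∫ x, g (T x) ∂μ = ∫ y, g y ∂ν := by
  rw [← hT.map_eq, integral_map hT.measurable.aemeasurable (by rw [hT.map_eq]; exact hg)]

variable {Ω : Type*} [MeasurableSpace Ω] {P : Measure Ω} {d : ℕ}

theorem integrable_inner_of_memLp {X Y : Ω → E d} (hX : MemLp X 2 P) (hY : MemLp Y 2 P) :
    Integrable (fun ω => inner ℝ (X ω) (Y ω)) P := by
  refine (hX.norm.integrable_mul hY.norm).mono
    (hX.aestronglyMeasurable.inner hY.aestronglyMeasurable) (.of_forall fun ω => ?_)
  simpa using abs_real_inner_le_norm (X ω) (Y ω)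

theorem integrable_norm_sq_of_memLp {X : Ω → E d} (hX : MemLp X 2 P) :
    Integrable (fun ω => ‖X ω‖ ^ 2) P :=
  hX.integrable_norm_pow two_ne_zero

theorem integral_norm_sum_sq_of_orthogonal {ι : Type*} (s : Finset ι) {Z : ι → Ω → E d}
    (hZ : ∀ p ∈ s, MemLp (Z p) 2 P)
    (horth : ∀ p ∈ s, ∀ q ∈ s, p ≠ q → ∫ ω, inner ℝ (Z p ω) (Z q ω) ∂P = 0) :
    ∫ ω, ‖∑ p ∈ s, Z p ω‖ ^ 2 ∂P = ∑ p ∈ s, ∫ ω, ‖Z p ω‖ ^ 2 ∂P := by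
  simp_rw [← real_inner_self_eq_norm_sq, inner_sum, sum_inner]
  rw [integral_finsetSum _ fun q hq => integrable_finsetSum _ fun p hp =>
    integrable_inner_of_memLp (hZ p hp) (hZ q hq)]
  refine Finset.sum_congr rfl fun q hq => ?_
  rw [integral_finsetSum _ fun p hp => integrable_inner_of_memLp (hZ p hp) (hZ q hq)]
  exact Finset.sum_eq_single_of_mem q hq fun p hp hpq => horth p hp q hq hpq

theorem integral_norm_const_add_smul_sq [IsProbabilityMeasure P] {X : Ω → E d} (hX : MemLp X 2 P)
    (h0 : ∫ ω, X ω ∂P = 0) (w : E d) (c : ℝ) :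
    ∫ ω, ‖w + c • X ω‖ ^ 2 ∂P = ‖w‖ ^ 2 + c ^ 2 * ∫ ω, ‖X ω‖ ^ 2 ∂P := by
  have hi : Integrable X P := hX.integrable one_le_two
  have h : ∀ ω, ‖w + c • X ω‖ ^ 2 = ‖w‖ ^ 2 + 2 * c * inner ℝ w (X ω) + c ^ 2 * ‖X ω‖ ^ 2 := by
    intro ω
    rw [norm_add_sq_real, real_inner_smul_right, norm_smul, mul_pow, Real.norm_eq_abs, sq_abs]
    ring
  have h1 : Integrable (fun ω => 2 * c * inner ℝ w (X ω)) P := (hi.const_inner w).const_mul _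
  have h2 : Integrable (fun ω => c ^ 2 * ‖X ω‖ ^ 2) P :=
    (integrable_norm_sq_of_memLp hX).const_mul _
  have h3 : Integrable (fun ω => ‖w‖ ^ 2 + 2 * c * inner ℝ w (X ω)) P :=
    (integrable_const _).add h1
  simp_rw [h]
  rw [integral_add h3 h2, integral_add (integrable_const _) h1, integral_const_mul,
    integral_const_mul, integral_inner hi, h0, inner_zero_right]
  simp

/-- A symmetry of the law that negates `X` and fixes `Y` negates the integral. This replaces an
appeal to independence for the Gaussian vectors. -/
theorem integral_inner_eq_zero_of_flip {X Y : Ω → E d} (hX : Measurable X) (hY : Measurable Y)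
    {T : Ω → Ω} (hT : MeasurePreserving T P P) (hXT : ∀ ω, X (T ω) = -X ω)
    (hYT : ∀ ω, Y (T ω) = Y ω) : ∫ ω, inner ℝ (X ω) (Y ω) ∂P = 0 := by
  have h := integral_comp_measurePreserving hT
    (g := fun ω => inner ℝ (X ω) (Y ω)) (hX.inner hY).aestronglyMeasurable
  simp only [hXT, hYT, inner_neg_left] at h
  rw [integral_neg] at h
  linarith

variable {n : ℕ}

theorem norm_honestMean_sq_le {H : Finset (Fin n)} (hH : H.Nonempty) (x : Fin n → E d) :
    ‖honestMean H x‖ ^ 2 ≤ (H.card : ℝ)⁻¹ * ∑ i ∈ H, ‖x i‖ ^ 2 := by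
  have hc : (0 : ℝ) < H.card := by exact_mod_cast hH.card_pos
  rw [honestMean, norm_smul, mul_pow, norm_inv, Real.norm_natCast]
  have h1 : ‖∑ i ∈ H, x i‖ ^ 2 ≤ H.card * ∑ i ∈ H, ‖x i‖ ^ 2 :=
    (pow_le_pow_left₀ (norm_nonneg _) (norm_sum_le _ _) 2).trans sq_sum_le_card_mul_sum_sq
  calc ((H.card : ℝ)⁻¹) ^ 2 * ‖∑ i ∈ H, x i‖ ^ 2
      ≤ ((H.card : ℝ)⁻¹) ^ 2 * (H.card * ∑ i ∈ H, ‖x i‖ ^ 2) := by gcongr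
    _ = _ := by field_simp

theorem sum_sub_honestMean {H : Finset (Fin n)} (hH : H.Nonempty) (x : Fin n → E d) :
    ∑ i ∈ H, (x i - honestMean H x) = 0 := by
  have hc : (H.card : ℝ) ≠ 0 := by exact_mod_cast hH.card_pos.ne'
  rw [Finset.sum_sub_distrib, Finset.sum_const, honestMean, ← Nat.cast_smul_eq_nsmul ℝ, smul_smul,
    mul_inv_cancel₀ hc, one_smul, sub_self]

theorem spread_le_sum_sq {H : Finset (Fin n)} (hH : H.Nonempty) (x : Fin n → E d) :
    spread H x ≤ (H.card : ℝ)⁻¹ * ∑ i ∈ H, ‖x i‖ ^ 2 := by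
  unfold spread
  gcongr ?_ * ?_
  set c := honestMean H x with hc
  have h : ∀ i, ‖x i‖ ^ 2 = ‖x i - c‖ ^ 2 + 2 * inner ℝ (x i - c) c + ‖c‖ ^ 2 := fun i => by
    rw [← norm_add_sq_real, sub_add_cancel]
  simp_rw [h, Finset.sum_add_distrib]
  rw [← Finset.mul_sum, ← sum_inner, sum_sub_honestMean hH, inner_zero_left]
  have : 0 ≤ ∑ i ∈ H, ‖c‖ ^ 2 := by positivity
  linarith

theorem honestMean_add (H : Finset (Fin n)) (x y : Fin n → E d) :
    honestMean H (fun i => x i + y i) = honestMean H x + honestMean H y := by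
  simp [honestMean, Finset.sum_add_distrib]

theorem honestMean_smul (H : Finset (Fin n)) (c : ℝ) (x : Fin n → E d) :
    honestMean H (fun i => c • x i) = c • honestMean H x := by
  rw [honestMean, ← Finset.smul_sum, smul_comm, honestMean]

theorem norm_convex_comb_sq_le {β : ℝ} (h0 : 0 ≤ β) (h1 : β ≤ 1) (a b : E d) :
    ‖β • a + (1 - β) • b‖ ^ 2 ≤ β * ‖a‖ ^ 2 + (1 - β) * ‖b‖ ^ 2 := by
  have h2 : ‖β • a + (1 - β) • b‖ ≤ β * ‖a‖ + (1 - β) * ‖b‖ := by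
    refine (norm_add_le _ _).trans_eq ?_
    rw [norm_smul, norm_smul, Real.norm_of_nonneg h0, Real.norm_of_nonneg (sub_nonneg.2 h1)]
  have h3 := pow_le_pow_left₀ (norm_nonneg _) h2 2
  nlinarith [mul_nonneg (mul_nonneg h0 (sub_nonneg.2 h1)) (sq_nonneg (‖a‖ - ‖b‖))]

theorem memLp_honestMean {H : Finset (Fin n)} {X : Fin n → Ω → E d}
    (hX : ∀ i ∈ H, MemLp (X i) 2 P) : MemLp (fun ω => honestMean H fun i => X i ω) 2 P := by
  have h := (memLp_finsetSum H hX).const_smul (H.card : ℝ)⁻¹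
  exact h

theorem integral_honestMean [IsFiniteMeasure P] {H : Finset (Fin n)} {X : Fin n → Ω → E d}
    (hX : ∀ i ∈ H, MemLp (X i) 2 P) (h0 : ∀ i ∈ H, ∫ ω, X i ω ∂P = 0) :
    ∫ ω, honestMean H (fun i => X i ω) ∂P = 0 := by
  unfold honestMean
  rw [integral_smul, integral_finsetSum _ fun i hi => (hX i hi).integrable one_le_two,
    Finset.sum_eq_zero h0, smul_zero]

theorem memLp_const_add_smul [IsFiniteMeasure P] {X : Ω → E d} (hX : MemLp X 2 P) (w : E d)
    (c : ℝ) : MemLp (fun ω => w + c • X ω) 2 P := by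
  have h1 := hX.const_smul c
  have h2 : MemLp (fun _ : Ω => w) 2 P := memLp_const w
  exact h2.add h1

/-- Momentum step: the squared error of the averaged momentum. -/
theorem lintegral_norm_honestMean_sub_sq [IsProbabilityMeasure P] {H : Finset (Fin n)}
    {X : Fin n → Ω → E d} (hX : ∀ i ∈ H, MemLp (X i) 2 P) (h0 : ∀ i ∈ H, ∫ ω, X i ω ∂P = 0)
    {V : ℝ} (hV : ∫ ω, ‖honestMean H fun i => X i ω‖ ^ 2 ∂P ≤ V) (m g : Fin n → E d)
    {a c : ℝ} (ha : 0 ≤ a) (hc : 0 ≤ c) (β : ℝ) :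
    ∫⁻ ω, ENNReal.ofReal (a + c * ‖honestMean H (fun i => β • m i + (1 - β) • (g i + X i ω))
        - honestMean H g‖ ^ 2) ∂P
      ≤ ENNReal.ofReal
        (a + c * (β ^ 2 * ‖honestMean H m - honestMean H g‖ ^ 2 + (1 - β) ^ 2 * V)) := by
  have e : ∀ ω, honestMean H (fun i => β • m i + (1 - β) • (g i + X i ω)) - honestMean H g
      = β • (honestMean H m - honestMean H g) + (1 - β) • honestMean H fun i => X i ω := by
    intro ω
    rw [honestMean_add, honestMean_smul, honestMean_smul, honestMean_add]
    module
  have hM := memLp_honestMean hX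
  have hM' : MemLp (fun ω => β • (honestMean H m - honestMean H g)
      + (1 - β) • honestMean H fun i => X i ω) 2 P := 
    memLp_const_add_smul hM _ _
  have hi := (integrable_norm_sq_of_memLp hM').const_mul c
  simp_rw [e]
  have hi' : Integrable (fun ω => a + c * ‖β • (honestMean H m - honestMean H g)
      + (1 - β) • honestMean H fun i => X i ω‖ ^ 2) P := (integrable_const a).add hi
  have hpos : 0 ≤ᵐ[P] fun ω => a + c * ‖β • (honestMean H m - honestMean H g)
      + (1 - β) • honestMean H fun i => X i ω‖ ^ 2 :=
    .of_forall fun ω => add_nonneg ha (mul_nonneg hc (sq_nonneg _))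
  rw [← ofReal_integral_eq_lintegral_ofReal hi' hpos]
  refine ENNReal.ofReal_le_ofReal ?_
  rw [integral_add (integrable_const a) hi, integral_const_mul,
    integral_norm_const_add_smul_sq hM (integral_honestMean hX h0), norm_smul, mul_pow,
    Real.norm_eq_abs, sq_abs]
  simp only [integral_const, probReal_univ, one_smul]
  gcongr

/-- Momentum step: the spread of the honest momentums. -/
theorem lintegral_spread [IsProbabilityMeasure P] {H : Finset (Fin n)} (hH : H.Nonempty)
    {X : Fin n → Ω → E d} (hX : ∀ i ∈ H, MemLp (X i) 2 P) (h0 : ∀ i ∈ H, ∫ ω, X i ω ∂P = 0)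
    {V : ℝ} (hV : ∀ i ∈ H, ∫ ω, ‖X i ω‖ ^ 2 ∂P ≤ V) (m g : Fin n → E d)
    {β : ℝ} (hβ0 : 0 ≤ β) (hβ1 : β ≤ 1) :
    ∫⁻ ω, ENNReal.ofReal (spread H fun i => β • m i + (1 - β) • (g i + X i ω)) ∂P
      ≤ ENNReal.ofReal (β * spread H m + (1 - β) * spread H g + (1 - β) ^ 2 * V) := by
  have hc : (0 : ℝ) < H.card := by exact_mod_cast hH.card_pos
  set Y : Fin n → Ω → E d := fun i ω => X i ω - honestMean H fun j => X j ω with hY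
  have hYL : ∀ i ∈ H, MemLp (Y i) 2 P := fun i hi => (hX i hi).sub (memLp_honestMean hX)
  have hY0 : ∀ i ∈ H, ∫ ω, Y i ω ∂P = 0 := fun i hi => by
    simp only [hY]
    rw [integral_sub ((hX i hi).integrable one_le_two)
      ((memLp_honestMean hX).integrable one_le_two), h0 i hi, integral_honestMean hX h0, sub_zero]
  -- The deviation of the new momentum from its average is the deterministic `w i` plus `1 - β`
  -- times the centred `Y i`. The cross term integrates to zero; convexity of the squared norm
  -- bounds `w i`.
  set w : Fin n → E d := fun i =>
    β • (m i - honestMean H m) + (1 - β) • (g i - honestMean H g) with hw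
  have e : ∀ ω, spread H (fun i => β • m i + (1 - β) • (g i + X i ω))
      = (H.card : ℝ)⁻¹ * ∑ i ∈ H, ‖w i + (1 - β) • Y i ω‖ ^ 2 := by
    intro ω
    unfold spread
    congr 1
    refine Finset.sum_congr rfl fun i _ => ?_
    congr 2
    rw [honestMean_add, honestMean_smul, honestMean_smul, honestMean_add]
    simp only [hw, hY]
    module
  have hL : ∀ i ∈ H, MemLp (fun ω => w i + (1 - β) • Y i ω) 2 P := fun i hi =>
    memLp_const_add_smul (hYL i hi) _ _
  have hi : Integrable (fun ω => (H.card : ℝ)⁻¹ * ∑ i ∈ H, ‖w i + (1 - β) • Y i ω‖ ^ 2) P :=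
    (integrable_finsetSum _ fun i hi => integrable_norm_sq_of_memLp (hL i hi)).const_mul _
  simp_rw [e]
  have hpos : 0 ≤ᵐ[P] fun ω => (H.card : ℝ)⁻¹ * ∑ i ∈ H, ‖w i + (1 - β) • Y i ω‖ ^ 2 :=
    .of_forall fun ω => mul_nonneg (by positivity) (Finset.sum_nonneg fun i _ => sq_nonneg _)
  rw [← ofReal_integral_eq_lintegral_ofReal hi hpos]
  refine ENNReal.ofReal_le_ofReal ?_
  rw [integral_const_mul, integral_finsetSum _ fun i hi => integrable_norm_sq_of_memLp (hL i hi)]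
  have h1 : ∀ i ∈ H, ∫ ω, ‖w i + (1 - β) • Y i ω‖ ^ 2 ∂P
      = ‖w i‖ ^ 2 + (1 - β) ^ 2 * ∫ ω, ‖Y i ω‖ ^ 2 ∂P := fun i hi =>
    integral_norm_const_add_smul_sq (hYL i hi) (hY0 i hi) _ _
  rw [Finset.sum_congr rfl h1, Finset.sum_add_distrib, ← Finset.mul_sum, mul_add]
  have h2 : (H.card : ℝ)⁻¹ * ∑ i ∈ H, ‖w i‖ ^ 2 ≤ β * spread H m + (1 - β) * spread H g := by
    calc (H.card : ℝ)⁻¹ * ∑ i ∈ H, ‖w i‖ ^ 2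
        ≤ (H.card : ℝ)⁻¹ * ∑ i ∈ H, (β * ‖m i - honestMean H m‖ ^ 2
            + (1 - β) * ‖g i - honestMean H g‖ ^ 2) := by
          gcongr with i hi
          exact norm_convex_comb_sq_le hβ0 hβ1 _ _
      _ = _ := by
          unfold spread
          rw [Finset.sum_add_distrib, ← Finset.mul_sum, ← Finset.mul_sum]; ring
  have h3 : (H.card : ℝ)⁻¹ * ∑ i ∈ H, ∫ ω, ‖Y i ω‖ ^ 2 ∂P ≤ V := by
    rw [← integral_finsetSum _ fun i hi => integrable_norm_sq_of_memLp (hYL i hi),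
      ← integral_const_mul]
    calc ∫ ω, (H.card : ℝ)⁻¹ * ∑ i ∈ H, ‖Y i ω‖ ^ 2 ∂P
        ≤ ∫ ω, (H.card : ℝ)⁻¹ * ∑ i ∈ H, ‖X i ω‖ ^ 2 ∂P := by
          refine integral_mono ?_ ?_ fun ω => spread_le_sum_sq hH fun i => X i ω
          · exact (integrable_finsetSum _ fun i hi =>
              integrable_norm_sq_of_memLp (hYL i hi)).const_mul _
          · exact (integrable_finsetSum _ fun i hi =>
              integrable_norm_sq_of_memLp (hX i hi)).const_mul _
      _ = (H.card : ℝ)⁻¹ * ∑ i ∈ H, ∫ ω, ‖X i ω‖ ^ 2 ∂P := by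
          rw [integral_const_mul,
            integral_finsetSum _ fun i hi => integrable_norm_sq_of_memLp (hX i hi)]
      _ ≤ (H.card : ℝ)⁻¹ * (H.card • V) := by
          gcongr
          exact Finset.sum_le_card_nsmul _ _ _ hV
      _ = V := by rw [nsmul_eq_mul]; field_simp
  calc _ = (H.card : ℝ)⁻¹ * ∑ i ∈ H, ‖w i‖ ^ 2
        + (1 - β) ^ 2 * ((H.card : ℝ)⁻¹ * ∑ i ∈ H, ∫ ω, ‖Y i ω‖ ^ 2 ∂P) := by ring
    _ ≤ _ := by gcongr

end Moments

/-! ### Sampling without replacement -/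

section Batch

open Finset

variable {m b : ℕ}

/-- Double counting: each index lies in `(m - 1).choose (b - 1)` of the batches. -/
theorem sum_powersetCard_sum {V : Type*} [AddCommGroup V] [Module ℝ V] (hb : 1 ≤ b)
    (a : Fin m → V) :
    ∑ S ∈ univ.powersetCard b, ∑ j ∈ S, a j = ((m - 1).choose (b - 1) : ℝ) • ∑ j, a j := by
  have h : ∀ S : Finset (Fin m), ∑ j ∈ S, a j = ∑ j, if j ∈ S then a j else 0 := fun S => by
    rw [← sum_filter, filter_mem_eq_inter, univ_inter]
  simp_rw [h]
  rw [sum_comm, smul_sum]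
  refine sum_congr rfl fun j _ => ?_
  have h1 := card_filter_powersetCard_subset {j} (univ : Finset (Fin m)) b (subset_univ _)
    (by simpa using hb)
  simp only [singleton_subset_iff, card_univ, Fintype.card_fin, card_singleton] at h1
  rw [← sum_filter, sum_const, h1, Nat.cast_smul_eq_nsmul]
  simp

theorem isProbabilityMeasure_batchLaw (hbm : b ≤ m) : IsProbabilityMeasure (batchLaw m b) :=
  isProbabilityMeasure_uniformOn (finite_toSet _) (by
    rw [coe_nonempty, powersetCard_nonempty]; simpa using hbm)

theorem integral_batchLaw {V : Type*} [NormedAddCommGroup V] [NormedSpace ℝ V] [CompleteSpace V]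
    (g : Finset (Fin m) → V) :
    ∫ S, g S ∂(batchLaw m b) = (m.choose b : ℝ)⁻¹ • ∑ S ∈ univ.powersetCard b, g S := by
  rw [batchLaw, uniformOn, ProbabilityTheory.cond, integral_smul_measure,
    setIntegral_finset _ (Integrable.of_finite)]
  simp [Measure.count_apply_finset]

theorem ae_card_batchLaw : ∀ᵐ S ∂(batchLaw m b), S.card = b := by
  rw [batchLaw, uniformOn]
  filter_upwards [ae_cond_mem (Set.toFinite _).measurableSet] with S hS
  simpa using hS

theorem integral_batchLaw_average {V : Type*} [NormedAddCommGroup V] [NormedSpace ℝ V]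
    [CompleteSpace V] (hb : 1 ≤ b) (hbm : b ≤ m) (a : Fin m → V) :
    ∫ S, (S.card : ℝ)⁻¹ • ∑ j ∈ S, a j ∂(batchLaw m b) = (m : ℝ)⁻¹ • ∑ j, a j := by
  rw [integral_batchLaw]
  have h : ∀ S ∈ (univ : Finset (Fin m)).powersetCard b,
      (S.card : ℝ)⁻¹ • ∑ j ∈ S, a j = (b : ℝ)⁻¹ • ∑ j ∈ S, a j := fun S hS => by
    rw [(mem_powersetCard.1 hS).2]
  rw [sum_congr rfl h, ← smul_sum, sum_powersetCard_sum hb, smul_smul, smul_smul]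
  congr 1
  obtain ⟨b, rfl⟩ : ∃ k, b = k + 1 := ⟨b - 1, by omega⟩
  obtain ⟨m, rfl⟩ : ∃ k, m = k + 1 := ⟨m - 1, by omega⟩
  have h1 : (((m + 1) * m.choose b : ℕ) : ℝ) = ((m + 1).choose (b + 1) * (b + 1) : ℕ) :=
    congrArg _ (Nat.add_one_mul_choose_eq m b)
  have h2 : (((m + 1).choose (b + 1) : ℕ) : ℝ) ≠ 0 := by
    exact_mod_cast (Nat.choose_pos hbm).ne'
  push_cast at h1
  simp only [Nat.add_sub_cancel]
  push_cast
  field_simp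
  linarith

end Batch

/-! ### Symmetry and second moment of the Gaussian law -/

section Gaussian

variable {d : ℕ} {s : ℝ}

instance isProbabilityMeasure_gaussianLaw : IsProbabilityMeasure (gaussianLaw d s) :=
  Measure.isProbabilityMeasure_map (by fun_prop)

theorem measurePreserving_neg_gaussianLaw :
    MeasurePreserving (fun z : E d => -z) (gaussianLaw d s) (gaussianLaw d s) := by
  refine ⟨measurable_neg, ?_⟩
  have h := stdGaussian_map (LinearIsometryEquiv.neg ℝ (E := E d))
  conv_rhs => rw [gaussianLaw, ← h, Measure.map_map (by fun_prop) (by fun_prop)]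
  rw [gaussianLaw, Measure.map_map (by fun_prop) (by fun_prop)]
  congr 1
  ext z : 1
  simp

theorem memLp_gaussianLaw : MemLp (fun z : E d => z) 2 (gaussianLaw d s) := by
  rw [gaussianLaw, memLp_map_measure_iff (by fun_prop) (by fun_prop)]
  exact (IsGaussian.memLp_two_id (μ := stdGaussian (E d))).const_smul (√s)

theorem integral_norm_sq_stdGaussian : ∫ z, ‖z‖ ^ 2 ∂(stdGaussian (E d)) = d := by
  have hi := IsGaussian.memLp_two_id (μ := stdGaussian (E d))
  have h : ∀ k : Fin d, ∫ z : E d, z k ^ 2 ∂(stdGaussian (E d)) = 1 := fun k => by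
    have hv := variance_dual_stdGaussian (innerSL ℝ (EuclideanSpace.single k (1 : ℝ) : E d))
    rw [variance_of_integral_eq_zero (by fun_prop) (integral_strongDual_stdGaussian _)] at hv
    simpa [EuclideanSpace.inner_single_left] using hv
  simp_rw [EuclideanSpace.real_norm_sq_eq]
  rw [integral_finsetSum]
  · simp [h]
  · intro k _
    refine (hi.integrable_norm_pow two_ne_zero).mono (by fun_prop) (.of_forall fun z => ?_)
    have := PiLp.norm_apply_le z k
    simp only [norm_pow, norm_norm, id]
    gcongr

theorem integral_norm_sq_gaussianLaw (hs : 0 ≤ s) :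
    ∫ z, ‖z‖ ^ 2 ∂(gaussianLaw d s) = s * d := by
  rw [gaussianLaw, integral_map (by fun_prop) (by fun_prop)]
  simp_rw [norm_smul, mul_pow, Real.norm_eq_abs, sq_abs, Real.sq_sqrt hs]
  rw [integral_const_mul, integral_norm_sq_stdGaussian]

end Gaussian

/-! ### The noise of one round -/

section Noise

open Finset

variable {n m d b : ℕ} {s : ℝ}

theorem eq_zero_of_eq_neg {x : E d} (h : x = -x) : x = 0 := by
  have h2 : (2 : ℝ) • x = 0 := by rw [two_smul]; nth_rw 2 [h]; exact add_neg_cancel x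
  exact (smul_eq_zero.1 h2).resolve_left two_ne_zero

theorem isProbabilityMeasure_roundLaw (hbm : b ≤ m) (s s' : ℝ) :
    IsProbabilityMeasure (roundLaw n m d b s s') := by
  have := isProbabilityMeasure_batchLaw hbm
  unfold roundLaw; infer_instance

theorem measurePreserving_batch (hbm : b ≤ m) (i : Fin n) :
    MeasurePreserving (fun ρ : Round n m d => ρ.1 i) (roundLaw n m d b s s) (batchLaw m b) := by
  have := isProbabilityMeasure_batchLaw hbm
  exact (measurePreserving_eval (fun _ : Fin n => batchLaw m b) i).comp measurePreserving_fst

theorem measurePreserving_shared (hbm : b ≤ m) (i j : Fin n) :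
    MeasurePreserving (fun ρ : Round n m d => ρ.2.1 i j) (roundLaw n m d b s s)
      (gaussianLaw d s) := by
  have := isProbabilityMeasure_batchLaw hbm
  exact (measurePreserving_eval (fun _ : Fin n => gaussianLaw d s) j).comp
    ((measurePreserving_eval
      (fun _ : Fin n => Measure.pi fun _ : Fin n => gaussianLaw d s) i).comp
      (measurePreserving_fst.comp measurePreserving_snd))

theorem measurePreserving_own (hbm : b ≤ m) (i : Fin n) :
    MeasurePreserving (fun ρ : Round n m d => ρ.2.2 i) (roundLaw n m d b s s)
      (gaussianLaw d s) := by
  have := isProbabilityMeasure_batchLaw hbm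
  exact (measurePreserving_eval (fun _ : Fin n => gaussianLaw d s) i).comp
    (measurePreserving_snd.comp measurePreserving_snd)

/-- Change of sign of the Gaussian vectors marked by `p` and `q`. -/
def flip (p : Fin n → Fin n → Prop) (q : Fin n → Prop) [∀ i j, Decidable (p i j)]
    [∀ i, Decidable (q i)] (ρ : Round n m d) : Round n m d :=
  (ρ.1, fun i j => if p i j then -ρ.2.1 i j else ρ.2.1 i j,
    fun i => if q i then -ρ.2.2 i else ρ.2.2 i)

theorem measurePreserving_flip (hbm : b ≤ m) (p : Fin n → Fin n → Prop) (q : Fin n → Prop)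
    [∀ i j, Decidable (p i j)] [∀ i, Decidable (q i)] :
    MeasurePreserving (flip p q : Round n m d → Round n m d) (roundLaw n m d b s s)
      (roundLaw n m d b s s) := by
  have := isProbabilityMeasure_batchLaw hbm
  have key : ∀ (c : Prop) [Decidable c], MeasurePreserving
      (fun z : E d => if c then -z else z) (gaussianLaw d s) (gaussianLaw d s) := fun c _ => by
    by_cases h : c
    · simpa only [h, if_true] using measurePreserving_neg_gaussianLaw
    · simp only [h, if_false]
      exact MeasurePreserving.id (gaussianLaw d s)
  have h1 := measurePreserving_pi (fun _ : Fin n => Measure.pi fun _ : Fin n => gaussianLaw d s)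
    (fun _ : Fin n => Measure.pi fun _ : Fin n => gaussianLaw d s) fun i =>
      measurePreserving_pi (fun _ : Fin n => gaussianLaw d s) (fun _ : Fin n => gaussianLaw d s)
        fun j => key (p i j)
  have h2 := measurePreserving_pi (fun _ : Fin n => gaussianLaw d s)
    (fun _ : Fin n => gaussianLaw d s) fun i => key (q i)
  exact (MeasurePreserving.id (Measure.pi fun _ : Fin n => batchLaw m b)).prod (h1.prod h2)

/-- The independent noise of `i` for `i = j`, and the noise shared by `i` and `j` otherwise. -/
def pairNoise (i j : Fin n) (ρ : Round n m d) : E d :=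
  if i = j then ρ.2.2 i else corNoise ρ i j

theorem noise_eq_sum_pairNoise (ρ : Round n m d) (i : Fin n) :
    noise ρ i = ∑ j, pairNoise i j ρ := by
  rw [← sum_erase_add _ _ (mem_univ i), noise]
  congr 1
  · refine sum_congr rfl fun j hj => ?_
    rw [pairNoise, if_neg (ne_of_mem_erase hj).symm]
  · rw [pairNoise, if_pos rfl]

theorem pairNoise_antisymm {i j : Fin n} (h : i ≠ j) (ρ : Round n m d) :
    pairNoise i j ρ = -pairNoise j i ρ := by
  rw [pairNoise, pairNoise, if_neg h, if_neg h.symm, corNoise, corNoise]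
  rcases lt_or_gt_of_ne h with h | h
  · rw [if_pos h, if_neg h.not_gt, neg_neg]
  · rw [if_neg h.not_gt, if_pos h]

/-- Antisymmetry cancels the noise shared inside `S`. Each member keeps only its own vector and
those shared with the complement: `n - |S| + 1` vectors instead of `n`. -/
theorem sum_noise_eq (S : Finset (Fin n)) (ρ : Round n m d) :
    ∑ i ∈ S, noise ρ i = ∑ i ∈ S, ∑ j ∈ insert i Sᶜ, pairNoise i j ρ := by
  set c : Fin n → Fin n → E d := fun i j => if i = j then 0 else pairNoise i j ρ with hc
  have hcz : ∑ i ∈ S, ∑ j ∈ S, c i j = 0 := by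
    refine eq_zero_of_eq_neg ?_
    rw [← sum_neg_distrib]
    conv_lhs => rw [sum_comm]
    refine sum_congr rfl fun i _ => ?_
    rw [← sum_neg_distrib]
    refine sum_congr rfl fun j _ => ?_
    simp only [hc]
    by_cases h : i = j
    · simp [h]
    · rw [if_neg h, if_neg (Ne.symm h), pairNoise_antisymm (Ne.symm h)]
  have h1 : ∀ i ∈ S, noise ρ i
      = ∑ j ∈ insert i Sᶜ, pairNoise i j ρ + ∑ j ∈ S, c i j := fun i hi => by
    have h2 : ∑ j ∈ S, pairNoise i j ρ = pairNoise i i ρ + ∑ j ∈ S, c i j := by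
      rw [← add_sum_erase _ _ hi, ← add_sum_erase _ (c i) hi]
      simp only [hc, if_true, zero_add]
      congr 1
      exact sum_congr rfl fun j hj => by rw [if_neg (ne_of_mem_erase hj).symm]
    rw [noise_eq_sum_pairNoise, sum_insert (by simpa using hi), ← sum_add_sum_compl S, h2]
    abel
  rw [sum_congr rfl h1, sum_add_distrib, hcz, add_zero]

theorem measurable_pairNoise (i j : Fin n) :
    Measurable (pairNoise i j : Round n m d → E d) := by
  unfold pairNoise corNoise
  split_ifs <;> fun_prop

theorem memLp_pairNoise (hbm : b ≤ m) (i j : Fin n) :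
    MemLp (pairNoise i j : Round n m d → E d) 2 (roundLaw n m d b s s) := by
  unfold pairNoise corNoise
  split_ifs
  · exact memLp_gaussianLaw.comp_measurePreserving (measurePreserving_own hbm i)
  · exact memLp_gaussianLaw.comp_measurePreserving (measurePreserving_shared hbm i j)
  · exact (memLp_gaussianLaw.comp_measurePreserving (measurePreserving_shared hbm j i)).neg

theorem integral_norm_sq_pairNoise (hbm : b ≤ m) (hs : 0 ≤ s) (i j : Fin n) :
    ∫ ρ, ‖pairNoise i j ρ‖ ^ 2 ∂(roundLaw n m d b s s) = s * d := by
  have hm : AEStronglyMeasurable (fun z : E d => ‖z‖ ^ 2) (gaussianLaw d s) := by fun_prop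
  unfold pairNoise corNoise
  split_ifs
  · rw [← integral_norm_sq_gaussianLaw hs]
    exact integral_comp_measurePreserving (measurePreserving_own hbm i) hm
  · rw [← integral_norm_sq_gaussianLaw hs]
    exact integral_comp_measurePreserving (measurePreserving_shared hbm i j) hm
  · simp_rw [norm_neg]
    rw [← integral_norm_sq_gaussianLaw hs]
    exact integral_comp_measurePreserving (measurePreserving_shared hbm j i) hm

/-- The sign of the Gaussian vector behind the pair `(i, j)` is flipped. Both orders are marked
because only one is used, and the reversed pair is excluded because it is the same vector up to
sign. -/
theorem integral_inner_pairNoise (hbm : b ≤ m) {i j k l : Fin n} (h1 : ¬(i = k ∧ j = l))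
    (h2 : ¬(i = l ∧ j = k)) :
    ∫ ρ, inner ℝ (pairNoise i j ρ) (pairNoise k l ρ) ∂(roundLaw n m d b s s) = 0 := by
  refine integral_inner_eq_zero_of_flip (measurable_pairNoise i j) (measurable_pairNoise k l)
    (measurePreserving_flip hbm (fun u v => u = i ∧ v = j ∨ u = j ∧ v = i)
      (fun u => u = i ∧ u = j)) ?_ ?_
  · intro ρ
    unfold pairNoise corNoise flip
    by_cases hij : i = j
    · simp [hij]
    · simp only [hij, if_false]
      split_ifs <;> simp_all
  · intro ρ
    unfold pairNoise corNoise flip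
    by_cases hkl : k = l
    · subst hkl
      simp only [if_true]
      rw [if_neg fun h => h1 ⟨h.1.symm, h.2.symm⟩]
    · simp only [hkl, if_false]
      have n1 : ¬(k = i ∧ l = j ∨ k = j ∧ l = i) := fun h => h.elim
        (fun h => h1 ⟨h.1.symm, h.2.symm⟩) fun h => h2 ⟨h.2.symm, h.1.symm⟩
      have n2 : ¬(l = i ∧ k = j ∨ l = j ∧ k = i) := fun h => n1 (h.symm.imp And.symm And.symm)
      rw [if_neg n1, if_neg n2]

theorem memLp_noise (hbm : b ≤ m) (i : Fin n) :
    MemLp (fun ρ : Round n m d => noise ρ i) 2 (roundLaw n m d b s s) := by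
  simp_rw [noise_eq_sum_pairNoise]
  exact memLp_finsetSum _ fun j _ => memLp_pairNoise hbm i j

theorem integral_noise (hbm : b ≤ m) (i : Fin n) :
    ∫ ρ, noise ρ i ∂(roundLaw n m d b s s) = 0 := by
  have h := integral_comp_measurePreserving
    (measurePreserving_flip (d := d) (s := s) hbm (fun _ _ : Fin n => True) (fun _ => True))
    (memLp_noise hbm i).aestronglyMeasurable
  have h2 : ∀ ρ : Round n m d, noise (flip (fun _ _ => True) (fun _ => True) ρ) i
      = -noise ρ i := fun ρ => by
    simp_rw [noise_eq_sum_pairNoise, ← sum_neg_distrib]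
    refine sum_congr rfl fun j _ => ?_
    unfold pairNoise corNoise flip
    split_ifs <;> simp_all
  simp_rw [h2] at h
  rw [integral_neg] at h
  exact eq_zero_of_eq_neg h.symm

theorem integral_norm_sq_sum_noise (hbm : b ≤ m) (hs : 0 ≤ s) (S : Finset (Fin n)) :
    ∫ ρ, ‖∑ i ∈ S, noise ρ i‖ ^ 2 ∂(roundLaw n m d b s s)
      = S.card * ((n : ℝ) - S.card + 1) * (s * d) := by
  set R : Finset (Fin n × Fin n) := univ.filter fun p => p.1 ∈ S ∧ p.2 ∈ insert p.1 Sᶜ with hR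
  have hmem : ∀ p, p ∈ R ↔ p.1 ∈ S ∧ p.2 ∈ insert p.1 Sᶜ := fun p => by simp [hR]
  have h1 : ∀ ρ : Round n m d, ∑ i ∈ S, noise ρ i = ∑ p ∈ R, pairNoise p.1 p.2 ρ := fun ρ => by
    rw [sum_noise_eq, sum_finset_product R S (fun i => insert i Sᶜ) hmem]
  simp_rw [h1]
  rw [integral_norm_sum_sq_of_orthogonal R (fun p _ => memLp_pairNoise hbm p.1 p.2)]
  · simp_rw [integral_norm_sq_pairNoise hbm hs]
    rw [sum_finset_product R S (fun i => insert i Sᶜ) hmem]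
    have h2 : ∀ i ∈ S, ∑ _j ∈ insert i Sᶜ, s * (d : ℝ) = ((n : ℝ) - S.card + 1) * (s * d) := by
      intro i hi
      rw [sum_const, card_insert_of_notMem (by simpa using hi), card_compl, Fintype.card_fin,
        nsmul_eq_mul]
      push_cast [Nat.cast_sub ((card_le_univ S).trans_eq (Fintype.card_fin n))]
      ring
    rw [sum_congr rfl h2, sum_const, nsmul_eq_mul, mul_assoc]
  · rintro ⟨i, j⟩ hp ⟨k, l⟩ hq hne
    rw [hmem] at hp hq
    refine integral_inner_pairNoise hbm (fun h => hne (Prod.ext h.1 h.2)) ?_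
    -- Two reversed pairs in `R` would have both entries in `S`, which membership in `insert i Sᶜ`
    -- allows only on the diagonal.
    rintro ⟨rfl, rfl⟩
    simp only [mem_insert, mem_compl] at hp hq
    rcases hp.2 with h | h
    · exact hne (by rw [h])
    · exact h hq.1

end Noise

/-! ### Stochastic gradients -/

section StochasticGradient

open Finset

variable {X : Type*} {n m d b : ℕ} {s σ G : ℝ} {ℓ : E d → X → ℝ} {D : Fin n → Fin m → X}
  {H : Finset (Fin n)}

theorem gradient_const_mul_sum {ι : Type*} {S : Finset ι} {g : ι → E d → ℝ}
    (hg : ∀ i ∈ S, Differentiable ℝ (g i)) (c : ℝ) (θ : E d) :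
    gradient (fun θ => c * ∑ i ∈ S, g i θ) θ = c • ∑ i ∈ S, gradient (g i) θ := by
  have h : HasFDerivAt (fun θ => c * ∑ i ∈ S, g i θ) (c • ∑ i ∈ S, fderiv ℝ (g i) θ) θ :=
    (HasFDerivAt.fun_sum fun i hi => (hg i hi θ).hasFDerivAt).const_mul c
  rw [gradient, h.fderiv, map_smul, map_sum]
  rfl

theorem differentiable_localLoss {i : Fin n} (hd : ∀ j, Differentiable ℝ fun θ => ℓ θ (D i j)) :
    Differentiable ℝ (localLoss ℓ D i) := by
  unfold localLoss
  fun_prop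

theorem gradient_localLoss {i : Fin n} (hd : ∀ j, Differentiable ℝ fun θ => ℓ θ (D i j))
    (θ : E d) :
    gradient (localLoss ℓ D i) θ = (m : ℝ)⁻¹ • ∑ j, pointGrad ℓ (D i j) θ :=
  gradient_const_mul_sum (fun j _ => hd j) _ θ

theorem differentiable_honestLoss (hd : ∀ i ∈ H, ∀ j, Differentiable ℝ fun θ => ℓ θ (D i j)) :
    Differentiable ℝ (honestLoss ℓ D H) := by
  unfold honestLoss
  exact (Differentiable.fun_sum fun i hi => differentiable_localLoss (hd i hi)).const_mul _

theorem gradient_honestLoss (hd : ∀ i ∈ H, ∀ j, Differentiable ℝ fun θ => ℓ θ (D i j))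
    (θ : E d) :
    gradient (honestLoss ℓ D H) θ = honestMean H fun i => gradient (localLoss ℓ D i) θ :=
  gradient_const_mul_sum (fun i hi => differentiable_localLoss (hd i hi)) _ θ

/-- Testing the heterogeneity bound on the basis vectors and summing over coordinates produces the
factor `d`. -/
theorem spread_gradient_le (hd : ∀ i ∈ H, ∀ j, Differentiable ℝ fun θ => ℓ θ (D i j))
    (hG : BoundedHeterogeneity ℓ D H G) (θ : E d) :
    spread H (fun i => gradient (localLoss ℓ D i) θ) ≤ d * G ^ 2 := by
  rw [spread, ← gradient_honestLoss hd]
  simp_rw [EuclideanSpace.real_norm_sq_eq]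
  rw [sum_comm, mul_sum]
  have h : ∀ k ∈ (univ : Finset (Fin d)), (H.card : ℝ)⁻¹ * ∑ i ∈ H,
      (gradient (localLoss ℓ D i) θ - gradient (honestLoss ℓ D H) θ) k ^ 2 ≤ G ^ 2 := fun k _ => by
    have := hG θ (EuclideanSpace.single k 1) (by simp)
    simpa [EuclideanSpace.inner_single_left] using this
  refine (sum_le_card_nsmul _ _ _ h).trans_eq ?_
  simp

/-- Error of the mini-batch gradient on the batch `S`. -/
def batchError (ℓ : E d → X → ℝ) (D : Fin n → Fin m → X) (i : Fin n) (θ : E d)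
    (S : Finset (Fin m)) : E d :=
  batchGrad ℓ D i S θ - gradient (localLoss ℓ D i) θ

theorem memLp_batchError (hbm : b ≤ m) (i : Fin n) (θ : E d) :
    MemLp (batchError ℓ D i θ) 2 (batchLaw m b) := by
  have := isProbabilityMeasure_batchLaw hbm
  exact MemLp.of_discrete

theorem integral_batchError (hb : 1 ≤ b) (hbm : b ≤ m) {i : Fin n}
    (hd : ∀ j, Differentiable ℝ fun θ => ℓ θ (D i j)) (θ : E d) :
    ∫ S, batchError ℓ D i θ S ∂(batchLaw m b) = 0 := by
  have := isProbabilityMeasure_batchLaw hbm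
  unfold batchError batchGrad
  rw [integral_sub Integrable.of_finite (integrable_const _), integral_batchLaw_average hb hbm,
    gradient_localLoss hd]
  simp

/-- Jensen on the batch, then unbiasedness of batch averages. No gain in `b` is sought, since `σ`
does not appear in the final rate. -/
theorem integral_norm_sq_batchError_le (hb : 1 ≤ b) (hbm : b ≤ m) (hσ : BoundedVariance ℓ D H σ)
    {i : Fin n} (hi : i ∈ H) (θ : E d) :
    ∫ S, ‖batchError ℓ D i θ S‖ ^ 2 ∂(batchLaw m b) ≤ σ ^ 2 := by
  have := isProbabilityMeasure_batchLaw hbm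
  set g := gradient (localLoss ℓ D i) θ with hg
  have h : ∀ᵐ S ∂(batchLaw m b), ‖batchError ℓ D i θ S‖ ^ 2
      ≤ (S.card : ℝ)⁻¹ • ∑ j ∈ S, ‖pointGrad ℓ (D i j) θ - g‖ ^ 2 := by
    filter_upwards [ae_card_batchLaw] with S hS
    have hne : S.Nonempty := card_pos.1 (by omega)
    have hc : (S.card : ℝ) ≠ 0 := by exact_mod_cast hne.card_pos.ne'
    have e : batchError ℓ D i θ S = honestMean S fun j => pointGrad ℓ (D i j) θ - g := by
      rw [batchError, batchGrad, honestMean, sum_sub_distrib, smul_sub, sum_const,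
        ← Nat.cast_smul_eq_nsmul ℝ, smul_smul, inv_mul_cancel₀ hc, one_smul]
    rw [e]
    exact norm_honestMean_sq_le hne _
  refine (integral_mono_ae Integrable.of_finite Integrable.of_finite h).trans ?_
  rw [integral_batchLaw_average hb hbm]
  exact hσ i hi θ

/-- Error of the noisy gradient. -/
def gradError (ℓ : E d → X → ℝ) (D : Fin n → Fin m → X) (θ : E d) (i : Fin n)
    (ρ : Round n m d) : E d :=
  noisyGrad ℓ D ρ i θ - gradient (localLoss ℓ D i) θ

theorem gradError_eq (θ : E d) (i : Fin n) (ρ : Round n m d) :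
    gradError ℓ D θ i ρ = batchError ℓ D i θ (ρ.1 i) + noise ρ i := by
  rw [gradError, noisyGrad, batchError]; abel

theorem memLp_batchError_round (hbm : b ≤ m) (i : Fin n) (θ : E d) :
    MemLp (fun ρ : Round n m d => batchError ℓ D i θ (ρ.1 i)) 2 (roundLaw n m d b s s) :=
  (memLp_batchError hbm i θ).comp_measurePreserving (measurePreserving_batch hbm i)

theorem memLp_gradError (hbm : b ≤ m) (i : Fin n) (θ : E d) :
    MemLp (gradError ℓ D θ i) 2 (roundLaw n m d b s s) := by
  have h := (memLp_batchError_round (s := s) (ℓ := ℓ) (D := D) hbm i θ).add (memLp_noise hbm i)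
  convert h using 1
  ext1 ρ
  exact gradError_eq θ i ρ

theorem integral_gradError (hb : 1 ≤ b) (hbm : b ≤ m) {i : Fin n}
    (hd : ∀ j, Differentiable ℝ fun θ => ℓ θ (D i j)) (θ : E d) :
    ∫ ρ, gradError ℓ D θ i ρ ∂(roundLaw n m d b s s) = 0 := by
  have := isProbabilityMeasure_roundLaw (n := n) (d := d) hbm s s
  simp_rw [gradError_eq]
  rw [integral_add ((memLp_batchError_round hbm i θ).integrable one_le_two)
    ((memLp_noise hbm i).integrable one_le_two), integral_noise hbm, add_zero,
    ← integral_batchError hb hbm hd θ]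
  exact integral_comp_measurePreserving (measurePreserving_batch hbm i)
    (memLp_batchError hbm i θ).aestronglyMeasurable

theorem integral_norm_sq_batchError_round_le (hb : 1 ≤ b) (hbm : b ≤ m)
    (hσ : BoundedVariance ℓ D H σ) {i : Fin n} (hi : i ∈ H) (θ : E d) :
    ∫ ρ, ‖batchError ℓ D i θ (ρ.1 i)‖ ^ 2 ∂(roundLaw n m d b s s) ≤ σ ^ 2 := by
  have := isProbabilityMeasure_batchLaw hbm
  refine le_trans (le_of_eq ?_) (integral_norm_sq_batchError_le hb hbm hσ hi θ)
  exact integral_comp_measurePreserving (measurePreserving_batch (s := s) hbm i)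
    (g := fun S => ‖batchError ℓ D i θ S‖ ^ 2)
    ((memLp_batchError hbm i θ).aestronglyMeasurable.norm.pow 2)

theorem integral_norm_add_sq_le {Ω : Type*} [MeasurableSpace Ω] {P : Measure Ω} {Y Z : Ω → E d}
    (hY : MemLp Y 2 P) (hZ : MemLp Z 2 P) :
    ∫ ω, ‖Y ω + Z ω‖ ^ 2 ∂P ≤ 2 * ∫ ω, ‖Y ω‖ ^ 2 ∂P + 2 * ∫ ω, ‖Z ω‖ ^ 2 ∂P := by
  have h1 := (integrable_norm_sq_of_memLp hY).const_mul 2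
  have h2 := (integrable_norm_sq_of_memLp hZ).const_mul 2
  rw [← integral_const_mul, ← integral_const_mul, ← integral_add h1 h2]
  exact integral_mono (integrable_norm_sq_of_memLp (hY.add hZ)) (h1.add h2)
    fun ω => norm_add_sq_le_two_mul _ _

theorem integral_norm_sq_gradError_le (hb : 1 ≤ b) (hbm : b ≤ m) (hs : 0 ≤ s)
    (hσ : BoundedVariance ℓ D H σ) {i : Fin n} (hi : i ∈ H) (θ : E d) :
    ∫ ρ, ‖gradError ℓ D θ i ρ‖ ^ 2 ∂(roundLaw n m d b s s)
      ≤ 2 * σ ^ 2 + 2 * (n * (s * d)) := by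
  simp_rw [gradError_eq]
  refine (integral_norm_add_sq_le (memLp_batchError_round hbm i θ) (memLp_noise hbm i)).trans ?_
  have h1 := integral_norm_sq_batchError_round_le (s := s) hb hbm hσ hi θ
  have h2 := integral_norm_sq_sum_noise (d := d) hbm hs {i}
  simp only [sum_singleton, card_singleton, Nat.cast_one, sub_add_cancel, one_mul] at h2
  rw [h2]
  linarith

/-- The noise is treated exactly, to keep the cancellation inside `H`; the batch errors are bounded
crudely, with a factor 2 in place of independence. -/
theorem integral_norm_sq_honestMean_gradError_le (hb : 1 ≤ b) (hbm : b ≤ m) (hs : 0 ≤ s)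
    (hσ : BoundedVariance ℓ D H σ) (hH : H.Nonempty) (θ : E d) :
    ∫ ρ, ‖honestMean H fun i => gradError ℓ D θ i ρ‖ ^ 2 ∂(roundLaw n m d b s s)
      ≤ 2 * σ ^ 2 + 2 * (((n : ℝ) - H.card + 1) / H.card * (s * d)) := by
  have hc : (0 : ℝ) < H.card := by exact_mod_cast hH.card_pos
  simp_rw [gradError_eq, honestMean_add]
  have hB : ∀ i ∈ H, MemLp (fun ρ : Round n m d => batchError ℓ D i θ (ρ.1 i)) 2
    (roundLaw n m d b s s) := fun i _ => memLp_batchError_round hbm i θ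
  have hN : ∀ i ∈ H, MemLp (fun ρ : Round n m d => noise ρ i) 2
    (roundLaw n m d b s s) := fun i _ => memLp_noise hbm i
  refine (integral_norm_add_sq_le (memLp_honestMean hB) (memLp_honestMean hN)).trans ?_
  have hI : Integrable (fun ρ : Round n m d => (H.card : ℝ)⁻¹ * ∑ i ∈ H,
      ‖batchError ℓ D i θ (ρ.1 i)‖ ^ 2) (roundLaw n m d b s s) :=
    (integrable_finsetSum _ fun i hi => integrable_norm_sq_of_memLp (hB i hi)).const_mul _
  have h1 : ∫ ρ, ‖honestMean H fun i => batchError ℓ D i θ (ρ.1 i)‖ ^ 2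
      ∂(roundLaw n m d b s s) ≤ σ ^ 2 := by
    refine (integral_mono (integrable_norm_sq_of_memLp (memLp_honestMean hB)) hI
      fun ρ => norm_honestMean_sq_le hH _).trans ?_
    rw [integral_const_mul,
      integral_finsetSum _ fun i hi => integrable_norm_sq_of_memLp (hB i hi)]
    rw [inv_mul_le_iff₀ hc, ← nsmul_eq_mul]
    exact sum_le_card_nsmul _ _ _ fun i hi => integral_norm_sq_batchError_round_le hb hbm hσ hi θ
  have h2 : ∫ ρ, ‖honestMean H fun i => noise ρ i‖ ^ 2 ∂(roundLaw n m d b s s)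
      = ((n : ℝ) - H.card + 1) / H.card * (s * d) := by
    simp_rw [honestMean, norm_smul, mul_pow]
    rw [integral_const_mul, integral_norm_sq_sum_noise hbm hs, norm_inv, Real.norm_natCast]
    field_simp
  rw [h2]
  linarith

end StochasticGradient

/-! ### Resampling one round -/

section Resampling

variable {R : Type*} [MeasurableSpace R] (Q : Measure R) [IsProbabilityMeasure Q]

theorem measurePreserving_update_infinitePi (k : ℕ) :
    MeasurePreserving (fun p : (ℕ → R) × R => Function.update p.1 k p.2)
      ((Measure.infinitePi fun _ : ℕ => Q).prod Q) (Measure.infinitePi fun _ : ℕ => Q) := by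
  have hm : Measurable fun p : (ℕ → R) × R => Function.update p.1 k p.2 := by
    refine measurable_pi_lambda _ fun j => ?_
    by_cases h : j = k
    · subst h; simpa using measurable_snd
    · simp only [Function.update_of_ne h]
      exact (measurable_pi_apply j).comp measurable_fst
  refine ⟨hm, Measure.eq_infinitePi _ fun s t ht => ?_⟩
  rw [Measure.map_apply hm (MeasurableSet.pi s.countable_toSet fun i _ => ht i)]
  by_cases hk : k ∈ s
  · have h : (fun p : (ℕ → R) × R => Function.update p.1 k p.2) ⁻¹' (s : Set ℕ).pi t
        = ((s.erase k : Finset ℕ) : Set ℕ).pi t ×ˢ t k := by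
      ext p
      simp only [Set.mem_preimage, Set.mem_pi, Set.mem_prod, Finset.mem_coe, Finset.mem_erase]
      constructor
      · refine fun h => ⟨fun i hi => ?_, ?_⟩
        · simpa [Function.update_of_ne hi.1] using h i hi.2
        · simpa using h k hk
      · rintro ⟨h1, h2⟩ i hi
        by_cases hik : i = k
        · subst hik; simpa using h2
        · simpa [Function.update_of_ne hik] using h1 i ⟨hik, hi⟩
    rw [h, Measure.prod_prod, Measure.infinitePi_pi _ fun i _ => ht i,
      Finset.prod_erase_mul _ _ hk]
  · have h : (fun p : (ℕ → R) × R => Function.update p.1 k p.2) ⁻¹' (s : Set ℕ).pi t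
        = (s : Set ℕ).pi t ×ˢ Set.univ := by
      ext p
      simp only [Set.mem_preimage, Set.mem_pi, Set.mem_prod, Finset.mem_coe, Set.mem_univ,
        and_true]
      refine forall₂_congr fun i hi => ?_
      rw [Function.update_of_ne (ne_of_mem_of_not_mem hi hk)]
    rw [h, Measure.prod_prod, Measure.infinitePi_pi _ fun i _ => ht i, measure_univ, mul_one]

/-- Fubini form of conditioning on all rounds but `k`: that round is replaced by a fresh copy,
integrated first. With nonnegative integrands, no integrability has to be known beforehand. -/
theorem lintegral_resample {A : Type*} [MeasurableSpace A] (ν : Measure A) [SFinite ν] (k : ℕ)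
    {Φ : A × (ℕ → R) → ENNReal} (hΦ : Measurable Φ) :
    ∫⁻ s, Φ s ∂(ν.prod (Measure.infinitePi fun _ : ℕ => Q))
      = ∫⁻ s, ∫⁻ ρ, Φ (s.1, Function.update s.2 k ρ) ∂Q
          ∂(ν.prod (Measure.infinitePi fun _ : ℕ => Q)) := by
  have hu := measurePreserving_update_infinitePi Q k
  have hΨ : Measurable fun q : (A × (ℕ → R)) × R => Φ (q.1.1, Function.update q.1.2 k q.2) :=
    hΦ.comp ((measurable_fst.comp measurable_fst).prodMk
      (hu.measurable.comp ((measurable_snd.comp measurable_fst).prodMk measurable_snd)))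
  rw [lintegral_prod _ hΦ.aemeasurable, lintegral_prod _ hΨ.lintegral_prod_right'.aemeasurable]
  refine lintegral_congr fun a => ?_
  have ha : Measurable fun ω => Φ (a, ω) := hΦ.comp measurable_prodMk_left
  rw [← hu.lintegral_comp ha]
  exact lintegral_prod _ (ha.comp hu.measurable).aemeasurable

end Resampling

/-! ### Measurability of the run -/

section Measurability

variable {X : Type*} {n m d : ℕ} {ℓ : E d → X → ℝ} {D : Fin n → Fin m → X}
  {H : Finset (Fin n)}

/-- The sorting permutation is characterised by finitely many comparisons, ties being broken by
index; so the trimmed mean is piecewise linear on measurable pieces. -/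
theorem measurableSet_sort_eq (σ : Equiv.Perm (Fin n)) :
    MeasurableSet {x : Fin n → ℝ | σ = Tuple.sort x} := by
  have h : {x : Fin n → ℝ | σ = Tuple.sort x}
      = (⋂ i, ⋂ j, {x | i ≤ j → x (σ i) ≤ x (σ j)}) ∩
        ⋂ i, ⋂ j, {x | i < j → x (σ i) = x (σ j) → σ i < σ j} := by
    ext x
    simp only [Set.mem_ofPred_eq, Tuple.eq_sort_iff, Set.mem_inter_iff, Set.mem_iInter]
    rfl
  rw [h]
  refine MeasurableSet.inter (.iInter fun i => .iInter fun j => ?_)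
    (.iInter fun i => .iInter fun j => ?_)
  · by_cases h : i ≤ j
    · simp only [h, true_imp_iff]
      exact measurableSet_le (measurable_pi_apply _) (measurable_pi_apply _)
    · simp [h]
  · by_cases h : i < j
    · by_cases h' : σ i < σ j
      · simp [h']
      · simp only [h, h', true_imp_iff, imp_false]
        exact (measurableSet_eq_fun (measurable_pi_apply (σ i)) (measurable_pi_apply (σ j))).compl
    · simp [h]

theorem measurable_real_smul {α : Type*} [MeasurableSpace α] (c : ℝ) {g : α → E d}
    (hg : Measurable g) : Measurable fun x => c • g x :=
  hg.const_smul c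

theorem measurable_add_fun {α : Type*} [MeasurableSpace α] {f g : α → E d} (hf : Measurable f)
    (hg : Measurable g) : Measurable fun x => f x + g x :=
  hf.add hg

theorem measurable_trimmedMean (f : ℕ) :
    Measurable (trimmedMean f : (Fin n → ℝ) → ℝ) := by
  classical
  have h : (trimmedMean f : (Fin n → ℝ) → ℝ) = fun x => ∑ σ : Equiv.Perm (Fin n),
      if σ = Tuple.sort x then ((n : ℝ) - 2 * f)⁻¹ *
        ∑ r ∈ Finset.univ.filter (fun r : Fin n => f ≤ (r : ℕ) ∧ (r : ℕ) + f < n), x (σ r)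
      else 0 := by
    ext x
    rw [Finset.sum_ite_eq' Finset.univ, if_pos (Finset.mem_univ _)]
    rfl
  rw [h]
  exact Finset.measurable_fun_sum _ fun σ _ => Measurable.ite (measurableSet_sort_eq σ)
    (by fun_prop) measurable_const

theorem measurable_cwtm (f : ℕ) : Measurable (cwtm f : (Fin n → E d) → E d) := by
  unfold cwtm
  refine (WithLp.measurable_toLp 2 _).comp (measurable_pi_lambda _ fun k => ?_)
  exact (measurable_trimmedMean f).comp (by fun_prop)

theorem measurable_gradient (F : E d → ℝ) : Measurable (gradient F) :=
  (InnerProductSpace.toDual ℝ (E d)).symm.continuous.measurable.comp (measurable_fderiv ℝ F)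

theorem measurable_batchGrad (i : Fin n) :
    Measurable fun q : Finset (Fin m) × E d => batchGrad ℓ D i q.1 q.2 := by
  refine measurable_from_prod_countable_right fun S => ?_
  have h1 : ∀ j ∈ S, Measurable fun θ : E d => pointGrad ℓ (D i j) θ := fun j _ =>
    measurable_gradient fun θ => ℓ θ (D i j)
  have h2 : Measurable fun θ : E d => ∑ j ∈ S, pointGrad ℓ (D i j) θ :=
    Finset.measurable_fun_sum S h1
  exact measurable_real_smul (S.card : ℝ)⁻¹ h2

theorem measurable_noise (i : Fin n) : Measurable fun ρ : Round n m d => noise ρ i := by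
  simp_rw [noise_eq_sum_pairNoise]
  exact Finset.measurable_fun_sum _ fun j _ => measurable_pairNoise i j

theorem measurable_noisyGrad (i : Fin n) :
    Measurable fun q : Round n m d × E d => noisyGrad ℓ D q.1 i q.2 := by
  unfold noisyGrad
  have h1 : Measurable fun q : Round n m d × E d => noise q.1 i :=
    (measurable_noise i).comp measurable_fst
  have h2 : Measurable fun q : Round n m d × E d => (q.1.1 i, q.2) := by fun_prop
  have h3 := (measurable_batchGrad (ℓ := ℓ) (D := D) i).comp h2
  simp only [Function.comp_def] at h3
  exact measurable_add_fun h3 h1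

variable {A : Type} [MeasurableSpace A]

/-- The model after step `t`, a function of the rounds up to `t`. -/
def nextModel (ℓ : E d → X → ℝ) (D : Fin n → Fin m → X) (H : Finset (Fin n)) (p : Params n d)
    (adv : Adversary n m d A) (a : A) (ω : ℕ → Round n m d) (t : ℕ) : E d :=
  (state ℓ D H p adv a ω t).1 - p.lr t • p.agg fun i =>
    if i ∈ H then (state ℓ D H p adv a ω t).2 i else adv.msg t (a, fun k => ω k) i

theorem state_succ (p : Params n d) (adv : Adversary n m d A) (a : A) (ω : ℕ → Round n m d)
    (t : ℕ) :
    state ℓ D H p adv a ω (t + 1) = (nextModel ℓ D H p adv a ω t, fun i =>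
      p.mom t • (state ℓ D H p adv a ω t).2 i
        + (1 - p.mom t) • noisyGrad ℓ D (ω (t + 1)) i (nextModel ℓ D H p adv a ω t)) :=
  rfl

theorem nextModel_congr {p : Params n d} {adv : Adversary n m d A} {a : A}
    {ω ω' : ℕ → Round n m d} {t : ℕ} (h : ∀ k ≤ t, ω k = ω' k)
    (hs : state ℓ D H p adv a ω t = state ℓ D H p adv a ω' t) :
    nextModel ℓ D H p adv a ω t = nextModel ℓ D H p adv a ω' t := by
  have : (fun k : Finset.Iic t => ω k) = fun k : Finset.Iic t => ω' k :=
    funext fun k => h k (Finset.mem_Iic.1 k.2)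
  rw [nextModel, nextModel, hs, this]

theorem state_congr {p : Params n d} {adv : Adversary n m d A} {a : A}
    {ω ω' : ℕ → Round n m d} {t : ℕ} (h : ∀ k ≤ t, ω k = ω' k) :
    state ℓ D H p adv a ω t = state ℓ D H p adv a ω' t := by
  induction t with
  | zero => rfl
  | succ t ih =>
    have ih := ih fun k hk => h k (hk.trans t.le_succ)
    rw [state_succ, state_succ, nextModel_congr (fun k hk => h k (hk.trans t.le_succ)) ih, ih,
      h (t + 1) le_rfl]

theorem state_update (p : Params n d) (adv : Adversary n m d A) (a : A) (ω : ℕ → Round n m d)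
    (t : ℕ) (ρ : Round n m d) :
    state ℓ D H p adv a (Function.update ω (t + 1) ρ) t = state ℓ D H p adv a ω t :=
  state_congr fun k hk => Function.update_of_ne (by omega) _ _

/-- Messages of step `t` see rounds up to `t` only, so `θ_{t+1}` ignores round `t + 1`. This is what
makes the gradient errors of that round centred whatever the adversary does. -/
theorem nextModel_update (p : Params n d) (adv : Adversary n m d A) (a : A)
    (ω : ℕ → Round n m d) (t : ℕ) (ρ : Round n m d) :
    nextModel ℓ D H p adv a (Function.update ω (t + 1) ρ) t = nextModel ℓ D H p adv a ω t :=
  nextModel_congr (fun k hk => Function.update_of_ne (by omega) _ _) (state_update p adv a ω t ρ)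

theorem measurable_nextModel {p : Params n d} (hp : Measurable p.agg) (adv : Adversary n m d A)
    {t : ℕ} (hs : Measurable fun s : A × (ℕ → Round n m d) => state ℓ D H p adv s.1 s.2 t) :
    Measurable fun s : A × (ℕ → Round n m d) => nextModel ℓ D H p adv s.1 s.2 t := by
  unfold nextModel
  refine hs.fst.sub (measurable_real_smul _ (hp.comp (measurable_pi_lambda _ fun i => ?_)))
  by_cases hi : i ∈ H
  · simp only [hi, if_true]
    exact (measurable_pi_apply i).comp hs.snd
  · simp only [hi, if_false]
    refine (measurable_pi_apply i).comp ((adv.measurable_msg t).comp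
      (measurable_fst.prodMk (measurable_pi_lambda _ fun k => ?_)))
    exact (measurable_pi_apply (k : ℕ)).comp measurable_snd

theorem measurable_state {p : Params n d} (hp : Measurable p.agg) (adv : Adversary n m d A)
    (t : ℕ) : Measurable fun s : A × (ℕ → Round n m d) => state ℓ D H p adv s.1 s.2 t := by
  induction t with
  | zero => exact measurable_const
  | succ t ih =>
    have hN := measurable_nextModel hp adv ih
    simp_rw [state_succ]
    refine hN.prodMk (measurable_pi_lambda _ fun i => ?_)
    have h1 : Measurable fun s : A × (ℕ → Round n m d) => (state ℓ D H p adv s.1 s.2 t).2 i :=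
      (measurable_pi_apply i).comp ih.snd
    have h2 : Measurable fun s : A × (ℕ → Round n m d) =>
        (s.2 (t + 1), nextModel ℓ D H p adv s.1 s.2 t) :=
      ((measurable_pi_apply (t + 1)).comp measurable_snd).prodMk hN
    have h3 := (measurable_noisyGrad (ℓ := ℓ) (D := D) i).comp h2
    simp only [Function.comp_def] at h3
    exact measurable_add_fun (measurable_real_smul _ h1) (measurable_real_smul _ h3)

theorem measurable_honestMean : Measurable (honestMean H : (Fin n → E d) → E d) := by
  unfold honestMean; fun_prop

theorem measurable_spread : Measurable (spread H : (Fin n → E d) → ℝ) := by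
  have := measurable_honestMean (d := d) (H := H)
  unfold spread; fun_prop

theorem measurable_lyapunov {F : E d → ℝ} (hF : Measurable F) (L : ℝ) :
    Measurable fun q : E d × E d => lyapunov L F q.1 q.2 := by
  have := measurable_gradient F
  unfold lyapunov; fun_prop

end Measurability

/-! ### Recursions along the run -/

section Recursion

variable {X : Type*} {n m d : ℕ} {ℓ : E d → X → ℝ} {D : Fin n → Fin m → X}
  {H : Finset (Fin n)} {σ G : ℝ} {p : Params n d} {A : Type} [MeasurableSpace A]

theorem noisyGrad_eq (ρ : Round n m d) (i : Fin n) (θ : E d) :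
    noisyGrad ℓ D ρ i θ = gradient (localLoss ℓ D i) θ + gradError ℓ D θ i ρ := by
  rw [gradError, add_sub_cancel]

theorem lintegral_spread_state_succ (hagg : Measurable p.agg) (hv : p.varInd = p.varCor)
    (hs : 0 ≤ p.varCor) (hb : 1 ≤ p.batchSize) (hbm : p.batchSize ≤ m)
    (hd : ∀ i ∈ H, ∀ j, Differentiable ℝ fun θ => ℓ θ (D i j))
    (hG : BoundedHeterogeneity ℓ D H G) (hσ : BoundedVariance ℓ D H σ) (hH : H.Nonempty)
    (adv : Adversary n m d A) (ν : Measure A) [IsProbabilityMeasure ν] (t : ℕ)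
    (hβ0 : 0 ≤ p.mom t) (hβ1 : p.mom t ≤ 1) :
    ∫⁻ s, ENNReal.ofReal (spread H (state ℓ D H p adv s.1 s.2 (t + 1)).2) ∂(runLaw m p ν)
      ≤ ENNReal.ofReal (p.mom t) *
          ∫⁻ s, ENNReal.ofReal (spread H (state ℓ D H p adv s.1 s.2 t).2) ∂(runLaw m p ν)
        + ENNReal.ofReal ((1 - p.mom t) * (d * G ^ 2)
          + (1 - p.mom t) ^ 2 * (2 * σ ^ 2 + 2 * (n * (p.varCor * d)))) := by
  have hprob := isProbabilityMeasure_roundLaw (n := n) (d := d) hbm p.varCor p.varCor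
  rw [runLaw, hv]
  have hM : ∀ t, Measurable fun s : A × (ℕ → Round n m d) =>
      ENNReal.ofReal (spread H (state ℓ D H p adv s.1 s.2 t).2) := fun t =>
    (measurable_spread.comp (measurable_state hagg adv t).snd).ennreal_ofReal
  rw [lintegral_resample _ ν (t + 1) (hM (t + 1)), ← lintegral_const_mul _ (hM t)]
  -- The additive constant is written as an integral against the probability law of the run, so that
  -- the comparison becomes pointwise.
  conv_rhs => rw [← mul_one (ENNReal.ofReal (_ + _)), ← measure_univ
    (μ := ν.prod (Measure.infinitePi fun _ : ℕ =>
      roundLaw n m d p.batchSize p.varCor p.varCor)), ← lintegral_const]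
  rw [← lintegral_add_right _ measurable_const]
  refine lintegral_mono fun s => ?_
  simp only [state_succ, state_update, nextModel_update, Function.update_self, noisyGrad_eq]
  rw [← ENNReal.ofReal_mul hβ0, ← ENNReal.ofReal_add (mul_nonneg hβ0 (spread_nonneg _ _))
    (add_nonneg (mul_nonneg (sub_nonneg.2 hβ1) (by positivity)) (by positivity))]
  refine (lintegral_spread hH (fun i _ => memLp_gradError hbm i _)
    (fun i hi => integral_gradError hb hbm (hd i hi) _)
    (fun i hi => integral_norm_sq_gradError_le hb hbm hs hσ hi _) _ _ hβ0 hβ1).trans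
      (ENNReal.ofReal_le_ofReal ?_)
  have := mul_le_mul_of_nonneg_left
    (spread_gradient_le hd hG (nextModel ℓ D H p adv s.1 s.2 t)) (sub_nonneg.2 hβ1)
  linarith

theorem lintegral_lyapunov_state_succ {f : ℕ} {L μ γ : ℝ} (hagg : p.agg = cwtm f)
    (hf : 2 * f < n) (hHc : H.card = n - f) (hv : p.varInd = p.varCor)
    (hs : 0 ≤ p.varCor) (hb : 1 ≤ p.batchSize) (hbm : p.batchSize ≤ m)
    (hd : ∀ i ∈ H, ∀ j, Differentiable ℝ fun θ => ℓ θ (D i j))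
    (hσ : BoundedVariance ℓ D H σ) (hL : 0 < L) (hμ : 0 < μ) (hμL : μ ≤ L)
    (hsm : IsSmooth L (honestLoss ℓ D H)) (hsc : IsStronglyConvex μ (honestLoss ℓ D H))
    (adv : Adversary n m d A) (ν : Measure A) [IsProbabilityMeasure ν] (t : ℕ)
    (hlr : p.lr t = γ) (hmom : p.mom t = 1 - 24 * L * γ) (hγ : 0 < γ) (hγL : 24 * L * γ ≤ 1) :
    ∫⁻ s, ENNReal.ofReal (lyapunov L (honestLoss ℓ D H) (state ℓ D H p adv s.1 s.2 (t + 1)).1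
        (honestMean H (state ℓ D H p adv s.1 s.2 (t + 1)).2)) ∂(runLaw m p ν)
      ≤ ENNReal.ofReal (1 - μ * γ) *
          ∫⁻ s, ENNReal.ofReal (lyapunov L (honestLoss ℓ D H) (state ℓ D H p adv s.1 s.2 t).1
            (honestMean H (state ℓ D H p adv s.1 s.2 t).2)) ∂(runLaw m p ν)
        + ENNReal.ofReal (γ * trimCoeff n f) *
          ∫⁻ s, ENNReal.ofReal (spread H (state ℓ D H p adv s.1 s.2 t).2) ∂(runLaw m p ν)
        + ENNReal.ofReal (1 / L * ((24 * L * γ) ^ 2 *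
          (2 * σ ^ 2 + 2 * (((n : ℝ) - H.card + 1) / H.card * (p.varCor * d))))) := by
  have hprob := isProbabilityMeasure_roundLaw (n := n) (d := d) hbm p.varCor p.varCor
  have haggm : Measurable p.agg := hagg ▸ measurable_cwtm f
  have hH : H.Nonempty := Finset.card_pos.1 (by omega)
  have hcard : (0 : ℝ) ≤ (n : ℝ) - H.card + 1 := by
    have : (H.card : ℝ) ≤ n := by exact_mod_cast hHc ▸ Nat.sub_le n f
    linarith
  rw [runLaw, hv]
  set F := honestLoss ℓ D H with hF
  have hFm : Measurable F := (differentiable_honestLoss hd).continuous.measurable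
  have hM : ∀ t, Measurable fun s : A × (ℕ → Round n m d) =>
      ENNReal.ofReal (spread H (state ℓ D H p adv s.1 s.2 t).2) := fun t =>
    (measurable_spread.comp (measurable_state haggm adv t).snd).ennreal_ofReal
  have hY : ∀ t, Measurable fun s : A × (ℕ → Round n m d) =>
      ENNReal.ofReal (lyapunov L F (state ℓ D H p adv s.1 s.2 t).1
        (honestMean H (state ℓ D H p adv s.1 s.2 t).2)) := fun t =>
    ((measurable_lyapunov hFm L).comp ((measurable_state haggm adv t).fst.prodMk
      (measurable_honestMean.comp (measurable_state haggm adv t).snd))).ennreal_ofReal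
  rw [lintegral_resample _ ν (t + 1) (hY (t + 1)), ← lintegral_const_mul _ (hM t),
    ← lintegral_const_mul _ (hY t)]
  conv_rhs => rw [← mul_one (ENNReal.ofReal (1 / L * _)), ← measure_univ
    (μ := ν.prod (Measure.infinitePi fun _ : ℕ =>
      roundLaw n m d p.batchSize p.varCor p.varCor)), ← lintegral_const]
  rw [← lintegral_add_left ((hY t).const_mul _), ← lintegral_add_right _ measurable_const]
  refine lintegral_mono fun s => ?_
  simp only [state_succ, state_update, nextModel_update, Function.update_self, noisyGrad_eq]
  have hμγ : 0 ≤ 1 - μ * γ := by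
    have := mul_le_mul_of_nonneg_right hμL hγ.le
    have : 0 ≤ L * γ := by positivity
    linarith
  have hκ : 0 ≤ γ * trimCoeff n f := mul_nonneg hγ.le (trimCoeff_nonneg hf)
  have hVnn : 0 ≤ 1 / L * ((24 * L * γ) ^ 2 *
      (2 * σ ^ 2 + 2 * (((n : ℝ) - H.card + 1) / H.card * (p.varCor * d)))) := by positivity
  rw [← ENNReal.ofReal_mul hμγ, ← ENNReal.ofReal_mul hκ,
    ← ENNReal.ofReal_add (mul_nonneg hμγ (lyapunov_nonneg hL hμ hsc _ _))
      (mul_nonneg hκ (spread_nonneg _ _)),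
    ← ENNReal.ofReal_add (add_nonneg (mul_nonneg hμγ (lyapunov_nonneg hL hμ hsc _ _))
      (mul_nonneg hκ (spread_nonneg _ _))) hVnn]
  set θ := (state ℓ D H p adv s.1 s.2 t).1 with hθ
  set M := (state ℓ D H p adv s.1 s.2 t).2 with hMdef
  set θ' := nextModel ℓ D H p adv s.1 s.2 t with hθ'
  set R := cwtm f fun i => if i ∈ H then M i else adv.msg t (s.1, fun k => s.2 k) i with hR
  have hθR : θ' = θ - γ • R := by rw [hθ', nextModel, hlr, hagg]
  have hstep := lintegral_norm_honestMean_sub_sq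
    (P := roundLaw n m d p.batchSize p.varCor p.varCor) (H := H)
    (X := fun i => gradError ℓ D θ' i) (fun i _ => memLp_gradError hbm i θ')
    (fun i hi => integral_gradError hb hbm (hd i hi) θ')
    (integral_norm_sq_honestMean_gradError_le hb hbm hs hσ hH θ') M
    (fun i => gradient (localLoss ℓ D i) θ') (sub_iInf_nonneg hμ hsc θ')
    (by positivity : 0 ≤ 1 / L) (p.mom t)
  rw [← gradient_honestLoss hd, ← hF] at hstep
  refine hstep.trans (ENNReal.ofReal_le_ofReal ?_)
  have hdesc := lyapunov_step hL hμ hμL hsm hsc hγ hγL θ (honestMean H M) R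
  rw [← hθR] at hdesc
  have hrob := norm_cwtm_sub_honestMean_sq_le hf hHc
    fun i => if i ∈ H then M i else adv.msg t (s.1, fun k => s.2 k) i
  rw [← hR, honestMean_congr (y := M) fun i hi => if_pos hi,
    spread_congr (y := M) fun i hi => if_pos hi] at hrob
  have hrob' := mul_le_mul_of_nonneg_left hrob hγ.le
  rw [hmom, show 1 - (1 - 24 * L * γ) = 24 * L * γ by ring, mul_add]
  linarith

end Recursion

/-! ### Solving the recursions -/

section Sequences

theorem div_sub_div_add_one_le {a u : ℝ} (ha : 0 ≤ a) (hu : 0 < u) :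
    a / u - a / u ^ 2 ≤ a / (u + 1) := by
  have h : a / (u + 1) - (a / u - a / u ^ 2) = a / (u ^ 2 * (u + 1)) := by field_simp; ring
  have : 0 ≤ a / (u ^ 2 * (u + 1)) := by positivity
  linarith

/-- The value `B` is a fixed point, and `2 q / (t + q) * V` is a supersolution for the noise as soon
as `q ≥ 2`. The first coefficient `1 - q / q` is zero. -/
theorem le_of_momentum_recursion {Y : ℕ → ENNReal} {q B V : ℝ} (hq : 2 ≤ q) (hB : 0 ≤ B)
    (hV : 0 ≤ V) (h0 : Y 0 = 0)
    (hY : ∀ t : ℕ, Y (t + 1) ≤ ENNReal.ofReal (1 - q / (t + q)) * Y t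
      + ENNReal.ofReal (q / (t + q) * B + (q / (t + q)) ^ 2 * V)) (t : ℕ) :
    Y t ≤ ENNReal.ofReal (B + 2 * (q / (t + q)) * V) := by
  induction t with
  | zero => rw [h0]; exact zero_le
  | succ t ih =>
    set u : ℝ := t + q with hu
    have hu0 : 0 < u := by positivity
    have hqu : q / u ≤ 1 := by rw [div_le_one hu0, hu]; linarith [t.cast_nonneg (α := ℝ)]
    have hqu0 : 0 ≤ q / u := by positivity
    refine (hY t).trans ((add_le_add_left (mul_le_mul_right ih _) _).trans ?_)
    rw [← ENNReal.ofReal_mul (sub_nonneg.2 hqu), ← ENNReal.ofReal_add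
      (mul_nonneg (sub_nonneg.2 hqu) (by positivity)) (by positivity)]
    refine ENNReal.ofReal_le_ofReal ?_
    have e : ((t + 1 : ℕ) : ℝ) + q = u + 1 := by push_cast; ring
    rw [e]
    have h1 := div_sub_div_add_one_le (by linarith : 0 ≤ q) hu0
    have h2 : 2 * (q / u ^ 2) ≤ (q / u) ^ 2 := by
      rw [div_pow, ← mul_div_assoc]; gcongr; nlinarith
    have h3 : 2 * (q / u) - (q / u) ^ 2 ≤ 2 * (q / (u + 1)) := by linarith
    have h4 := mul_le_mul_of_nonneg_right h3 hV
    calc _ = B + (2 * (q / u) - (q / u) ^ 2) * V := by ring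
      _ ≤ _ := by linarith

/-- With `u = t + 240 L / μ`, contraction takes `10 a / u²` from `a / u`, far more than the decrease
`a / u²` allowed plus the forcing `W / u²`; the constant `κ * B / μ` is a fixed point. The summand
with `Z₀` in `a` settles `t = 0`. -/
theorem le_of_descent_recursion {Y Z : ℕ → ENNReal} {L μ κ B V V' Z₀ : ℝ} (hμ : 0 < μ)
    (hμL : μ ≤ L) (hκ : 0 ≤ κ) (hB : 0 ≤ B) (hV : 0 ≤ V) (hV' : 0 ≤ V') (hZ₀ : 0 ≤ Z₀)
    (h0 : Z 0 ≤ ENNReal.ofReal Z₀)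
    (hY : ∀ t : ℕ, Y t ≤ ENNReal.ofReal (B + 2 * (240 * (L / μ) / (t + 240 * (L / μ))) * V))
    (hZ : ∀ t : ℕ, Z (t + 1) ≤ ENNReal.ofReal (1 - μ * stepSize L μ t) * Z t
      + ENNReal.ofReal (stepSize L μ t * κ) * Y t
      + ENNReal.ofReal (1 / L * ((24 * L * stepSize L μ t) ^ 2 * V'))) (t : ℕ) :
    Z t ≤ ENNReal.ofReal (κ * B / μ + (240 * (L / μ) * Z₀
      + L / μ ^ 2 * (4800 * κ * V + 57600 * V')) / (t + 240 * (L / μ))) := by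
  have hL : 0 < L := hμ.trans_le hμL
  set q := 240 * (L / μ) with hq
  have hq240 : 240 ≤ q := by
    have : 1 ≤ L / μ := (one_le_div hμ).2 hμL
    linarith
  -- Here `4800 = 10 * 2 * 240` comes from the decaying part of the spread, and `57600 = 240²` from
  -- the fresh noise.
  set W := L / μ ^ 2 * (4800 * κ * V + 57600 * V') with hW
  have hW0 : 0 ≤ W := by positivity
  set a := q * Z₀ + W with ha
  have ha0 : 0 ≤ a := by positivity
  have hWa : W ≤ a := by have : 0 ≤ q * Z₀ := by positivity
                         linarith
  induction t with
  | zero =>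
    refine h0.trans (ENNReal.ofReal_le_ofReal ?_)
    have h1 : Z₀ ≤ a / q := by
      rw [le_div_iff₀ (by positivity), ha, mul_comm]; linarith
    have h2 : 0 ≤ κ * B / μ := by positivity
    simp only [Nat.cast_zero, zero_add]
    linarith
  | succ t ih =>
    set u : ℝ := t + q with hu
    have hu0 : 0 < u := by positivity
    have hγ : stepSize L μ t = 10 / (μ * u) := rfl
    have hγ0 : 0 ≤ stepSize L μ t := by rw [hγ]; positivity
    have h1 : 0 ≤ 1 - μ * stepSize L μ t := by
      rw [hγ, sub_nonneg]
      have : μ * (10 / (μ * u)) = 10 / u := by field_simp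
      rw [this, div_le_one hu0, hu]
      linarith [t.cast_nonneg (α := ℝ)]
    refine (hZ t).trans ((add_le_add_left (add_le_add (mul_le_mul_right ih _)
      (mul_le_mul_right (hY t) _)) _).trans ?_)
    have p1 : 0 ≤ (1 - μ * stepSize L μ t) * (κ * B / μ + a / u) := by positivity
    have p2 : 0 ≤ stepSize L μ t * κ * (B + 2 * (q / u) * V) := by positivity
    rw [← ENNReal.ofReal_mul h1, ← ENNReal.ofReal_mul (by positivity),
      ← ENNReal.ofReal_add p1 p2, ← ENNReal.ofReal_add (add_nonneg p1 p2) (by positivity)]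
    refine ENNReal.ofReal_le_ofReal ?_
    have e : ((t + 1 : ℕ) : ℝ) + q = u + 1 := by push_cast; ring
    rw [e]
    have h2 := div_sub_div_add_one_le ha0 hu0
    have h3 : (1 - μ * stepSize L μ t) * (κ * B / μ + a / u)
        + stepSize L μ t * κ * (B + 2 * (q / u) * V)
        + 1 / L * ((24 * L * stepSize L μ t) ^ 2 * V')
        = κ * B / μ + (a / u - 10 * (a / u ^ 2)) + W / u ^ 2 := by
      rw [hγ, hW, hq]
      field_simp
      ring
    have h4 : W / u ^ 2 ≤ a / u ^ 2 := by gcongr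
    have h5 : 0 ≤ a / u ^ 2 := by positivity
    rw [h3]
    linarith

end Sequences

/-! ### Constants -/

section Constants

variable {n f : ℕ} {η : ℝ}

theorem two_mul_lt_of_ratio (hη : 0 < η) (hn : 1 ≤ n) (h : (2 + η) * (f : ℝ) ≤ n) :
    2 * f < n := by
  rcases Nat.eq_zero_or_pos f with hf | hf
  · omega
  · have : (0 : ℝ) < f := by exact_mod_cast hf
    have : (2 : ℝ) * f < n := by nlinarith
    exact_mod_cast this

theorem trimCoeff_le (hη : 0 < η) (hn : 1 ≤ n) (h : (2 + η) * (f : ℝ) ≤ n) :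
    trimCoeff n f ≤ 6 * ((2 + η) / η) ^ 2 * (f / n) := by
  have hf : (2 : ℝ) * f < n := by exact_mod_cast two_mul_lt_of_ratio hη hn h
  have hn0 : (0 : ℝ) < n := by exact_mod_cast hn
  have hf0 : (0 : ℝ) ≤ f := f.cast_nonneg
  -- Equivalent to `(2 + η) f ≤ n`; it keeps `n - 2 f` comparable to `n` and is the source of the
  -- dependence of the constant on `η`.
  have h1 : (n : ℝ) ≤ (2 + η) / η * (n - 2 * f) := by
    rw [div_mul_eq_mul_div, le_div_iff₀ hη]; nlinarith
  have h2 : (n : ℝ) ^ 2 ≤ ((2 + η) / η) ^ 2 * (n - 2 * f) ^ 2 := by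
    rw [← mul_pow]; exact pow_le_pow_left₀ hn0.le h1 2
  have h3 : (0 : ℝ) < n - 2 * f := by linarith
  rw [trimCoeff, div_le_iff₀ (by positivity)]
  calc 6 * (f : ℝ) * (n - f) ≤ 6 * f * n := by gcongr; linarith
    _ = 6 * (f / n) * n ^ 2 := by field_simp
    _ ≤ 6 * (f / n) * (((2 + η) / η) ^ 2 * (n - 2 * f) ^ 2) := by gcongr
    _ = _ := by ring

/-- The asymptotic bound obtained from the recursions, up to a vanishing term, is controlled by the
stated rate. -/
theorem asymptotic_bound_le (hη : 0 < η) (hn : 1 ≤ n) (h : (2 + η) * (f : ℝ) ≤ n)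
    {L μ Q B r s : ℝ} (hL : 0 < L) (hμ : 0 < μ) (hQ : 0 ≤ Q) (hB : 0 ≤ B)
    (hs : s = 32 * Q / ((n : ℝ) - f)) (hr : r ≤ L / μ ^ 2 * (Q / n ^ 2)) :
    trimCoeff n f * B / μ + r + L / μ ^ 2 * (9600 * trimCoeff n f * (n * s)
        + 115200 * (((f : ℝ) + 1) / ((n : ℝ) - f) * s))
      ≤ (20000000 * ((2 + η) / η) ^ 2 + 20000000) *
        (L / μ ^ 2 * (f / n * Q + Q / n ^ 2) + 1 / μ * (f / n * B)) := by
  have hf : (2 : ℝ) * f < n := by exact_mod_cast two_mul_lt_of_ratio hη hn h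
  have hn0 : (0 : ℝ) < n := by exact_mod_cast hn
  have hn1 : (1 : ℝ) ≤ n := by exact_mod_cast hn
  have hf0 : (0 : ℝ) ≤ f := f.cast_nonneg
  set w := ((2 + η) / η) ^ 2 with hw
  have hw0 : 0 ≤ w := by positivity
  have hκ := trimCoeff_le hη hn h
  have hκ0 := trimCoeff_nonneg (two_mul_lt_of_ratio hη hn h)
  rw [← hw] at hκ
  set κ := trimCoeff n f with hκd
  have hnf : (n : ℝ) / 2 ≤ n - f := by linarith
  have hnf0 : (0 : ℝ) < n - f := by linarith
  have hs1 : s ≤ 64 * Q / n := by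
    rw [hs, div_le_div_iff₀ hnf0 hn0]; nlinarith
  have hs0 : 0 ≤ s := by rw [hs]; positivity
  have hns : n * s ≤ 64 * Q := by
    calc n * s ≤ n * (64 * Q / n) := by gcongr
      _ = 64 * Q := by field_simp
  set x := (f : ℝ) / n with hx
  have hx0 : 0 ≤ x := by positivity
  have t1 : κ * (n * s) ≤ 384 * w * (x * Q) := by
    calc κ * (n * s) ≤ (6 * w * x) * (64 * Q) := by gcongr
      _ = _ := by ring
  have t2 : ((f : ℝ) + 1) / (n - f) * s ≤ 128 * (x * Q + Q / n ^ 2) := by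
    calc ((f : ℝ) + 1) / (n - f) * s ≤ (f + 1) / (n / 2) * (64 * Q / n) := by gcongr
      _ = 128 * (x * (Q / n) + Q / n ^ 2) := by rw [hx]; field_simp; ring
      _ ≤ 128 * (x * Q + Q / n ^ 2) := by
          gcongr
          exact div_le_self hQ hn1
  have t3 : κ * B / μ ≤ 6 * w * (1 / μ * (x * B)) := by
    calc κ * B / μ ≤ (6 * w * x) * B / μ := by gcongr
      _ = _ := by ring
  set c := L / μ ^ 2 with hc
  have hc0 : 0 ≤ c := by positivity
  have t4 : c * (9600 * κ * (n * s) + 115200 * (((f : ℝ) + 1) / (n - f) * s))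
      ≤ c * (9600 * (384 * w * (x * Q)) + 115200 * (128 * (x * Q + Q / n ^ 2))) := by
    refine mul_le_mul_of_nonneg_left ?_ hc0
    linarith
  have a1 : 0 ≤ c * (x * Q) := by positivity
  have a2 : 0 ≤ c * (Q / n ^ 2) := by positivity
  have a3 : 0 ≤ 1 / μ * (x * B) := by positivity
  have b1 := mul_nonneg hw0 a1
  have b2 := mul_nonneg hw0 a2
  have b3 := mul_nonneg hw0 a3
  -- The coefficients to dominate are `9600 * 384 = 3686400` with the factor `w`, and `115200 * 128
  -- + 1 = 14745601` without it, the `1` coming from `r`.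
  linarith

end Constants

/-! ### The robustness theorem -/

section Robustness

variable {X : Type*} {n m d f b : ℕ} {ℓ : E d → X → ℝ} {D : Fin n → Fin m → X}
  {H : Finset (Fin n)} {θ₀ : E d} {C ε δ L μ σ G : ℝ}

theorem noiseVar_nonneg (hf : 2 * f < n) (hδ : 0 < δ) (hδ1 : δ < 1) (T : ℕ) :
    0 ≤ noiseVar n f T C ε δ := by
  have : (2 : ℝ) * f < n := by exact_mod_cast hf
  have hf0 : (0 : ℝ) ≤ f := f.cast_nonneg
  have h1 : (0 : ℝ) ≤ n - f := by linarith
  have h2 : 0 ≤ Real.log (1 / δ) := Real.log_nonneg ((one_le_div hδ).2 hδ1.le)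
  unfold noiseVar
  positivity

/-- Bound on the expected Lyapunov function after `t` steps. -/
theorem lintegral_lyapunov_le (hf : 2 * f < n) (hHc : H.card = n - f) (hb : 1 ≤ b) (hbm : b ≤ m)
    (hδ : 0 < δ) (hδ1 : δ < 1) (hL : 0 < L) (hμ : 0 < μ) (hμL : μ ≤ L)
    (hd : ∀ i ∈ H, ∀ j, Differentiable ℝ fun θ => ℓ θ (D i j))
    (hG : BoundedHeterogeneity ℓ D H G) (hσ : BoundedVariance ℓ D H σ)
    (hsm : IsSmooth L (honestLoss ℓ D H)) (hsc : IsStronglyConvex μ (honestLoss ℓ D H))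
    (T : ℕ) {A : Type} [MeasurableSpace A] (adv : Adversary n m d A) (ν : Measure A)
    [IsProbabilityMeasure ν] (t : ℕ) :
    ∫⁻ s, ENNReal.ofReal (lyapunov L (honestLoss ℓ D H)
        (state ℓ D H (cwtmParams n d f b T C ε δ L μ θ₀) adv s.1 s.2 t).1
        (honestMean H (state ℓ D H (cwtmParams n d f b T C ε δ L μ θ₀) adv s.1 s.2 t).2))
        ∂(runLaw m (cwtmParams n d f b T C ε δ L μ θ₀) ν)
      ≤ ENNReal.ofReal (trimCoeff n f * (d * G ^ 2) / μ
        + (240 * (L / μ) * lyapunov L (honestLoss ℓ D H) θ₀ 0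
          + L / μ ^ 2 * (4800 * trimCoeff n f *
              (2 * σ ^ 2 + 2 * (n * (noiseVar n f T C ε δ * d)))
            + 57600 * (2 * σ ^ 2 + 2 * (((n : ℝ) - H.card + 1) / H.card *
              (noiseVar n f T C ε δ * d))))) / (t + 240 * (L / μ))) := by
  set p := cwtmParams n d f b T C ε δ L μ θ₀ with hp
  have hH : H.Nonempty := Finset.card_pos.1 (by omega)
  have hs : 0 ≤ noiseVar n f T C ε δ := noiseVar_nonneg hf hδ hδ1 T
  have hcard : (0 : ℝ) ≤ (n : ℝ) - H.card + 1 := by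
    have : (H.card : ℝ) ≤ n := by exact_mod_cast hHc ▸ Nat.sub_le n f
    linarith
  have hprob := isProbabilityMeasure_roundLaw (n := n) (d := d) hbm p.varCor p.varInd
  have hrun : IsProbabilityMeasure (runLaw m p ν) := by
    have : IsProbabilityMeasure (roundLaw n m d p.batchSize p.varCor p.varInd) := hprob
    unfold runLaw; infer_instance
  set q := 240 * (L / μ) with hq
  have hq240 : 240 ≤ q := by
    have : 1 ≤ L / μ := (one_le_div hμ).2 hμL
    linarith
  -- As `24 * 10 = 240`, the weight `1 - β_t` is exactly `q / (t + q)`, and `β_0 = 0`.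
  have hγ : ∀ t : ℕ, 24 * L * stepSize L μ t = q / (t + q) := fun t => by
    have : (t : ℝ) + q ≠ 0 := by positivity
    rw [stepSize, ← hq]
    rw [hq] at this ⊢
    field_simp
    ring
  have hγ1 : ∀ t : ℕ, 24 * L * stepSize L μ t ≤ 1 := fun t => by
    rw [hγ, div_le_one (by positivity)]
    linarith [t.cast_nonneg (α := ℝ)]
  have hγ0 : ∀ t : ℕ, 0 < stepSize L μ t := fun t => by
    unfold stepSize; rw [← hq]; positivity
  have hmom : ∀ t, p.mom t = 1 - 24 * L * stepSize L μ t := fun t => rfl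
  have hβ0 : ∀ t, 0 ≤ p.mom t := fun t => by rw [hmom]; linarith [hγ1 t]
  have hβ1 : ∀ t, p.mom t ≤ 1 := fun t => by
    rw [hmom]
    have : 0 < 24 * L * stepSize L μ t := mul_pos (by positivity) (hγ0 t)
    linarith
  have hY := le_of_momentum_recursion
    (Y := fun t => ∫⁻ s, ENNReal.ofReal (spread H (state ℓ D H p adv s.1 s.2 t).2)
      ∂(runLaw m p ν))
    (q := q) (B := d * G ^ 2) (V := 2 * σ ^ 2 + 2 * (n * (noiseVar n f T C ε δ * d)))
    (by linarith) (by positivity) (by positivity)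
    (by simp [state, spread, honestMean]) fun t => by
      have h := lintegral_spread_state_succ (p := p) (measurable_cwtm f) rfl hs hb hbm hd hG hσ hH
        adv ν t (hβ0 t) (hβ1 t)
      rw [hmom, sub_sub_cancel, hγ] at h
      exact h
  refine le_of_descent_recursion (Z := fun t => ∫⁻ s, ENNReal.ofReal (lyapunov L
    (honestLoss ℓ D H) (state ℓ D H p adv s.1 s.2 t).1
      (honestMean H (state ℓ D H p adv s.1 s.2 t).2)) ∂(runLaw m p ν)) hμ hμL
    (trimCoeff_nonneg hf) (by positivity) (by positivity) (by positivity)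
    (lyapunov_nonneg hL hμ hsc θ₀ 0) ?_ hY (fun t => ?_) t
  · have h0 : ∀ s : A × (ℕ → Round n m d), lyapunov L (honestLoss ℓ D H)
        (state ℓ D H p adv s.1 s.2 0).1 (honestMean H (state ℓ D H p adv s.1 s.2 0).2)
        = lyapunov L (honestLoss ℓ D H) θ₀ 0 := fun s => by
      simp [state, honestMean, hp, cwtmParams]
    simp_rw [h0]
    simp
  · exact lintegral_lyapunov_state_succ (p := p) rfl hf hHc rfl hs hb hbm hd hσ hL hμ hμL hsm hsc
      adv ν t rfl rfl (hγ0 t) (hγ1 t)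

/-- The suboptimality is nonnegative and below the Lyapunov function, so one `lintegral` bound gives
integrability and the bound on the expectation together. -/
theorem isRobust_of_lintegral_le {p : Params n d} {T : ℕ} {ϱ : ℝ} (hagg : Measurable p.agg)
    (hd : ∀ i ∈ H, ∀ j, Differentiable ℝ fun θ => ℓ θ (D i j)) (hL : 0 < L) (hμ : 0 < μ)
    (hsc : IsStronglyConvex μ (honestLoss ℓ D H)) (hϱ : 0 ≤ ϱ)
    (h : ∀ (A : Type) [MeasurableSpace A] (ν : Measure A) [IsProbabilityMeasure ν]
      (adv : Adversary n m d A), ∫⁻ s, ENNReal.ofReal (lyapunov L (honestLoss ℓ D H)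
        (state ℓ D H p adv s.1 s.2 T).1 (honestMean H (state ℓ D H p adv s.1 s.2 T).2))
        ∂(runLaw m p ν) ≤ ENNReal.ofReal ϱ) :
    IsRobust ℓ D H p T ϱ := by
  intro A _ ν _ adv
  have hm : Measurable fun s : A × (ℕ → Round n m d) =>
      honestLoss ℓ D H (state ℓ D H p adv s.1 s.2 T).1 - ⨅ θ, honestLoss ℓ D H θ :=
    ((differentiable_honestLoss hd).continuous.measurable.comp
      (measurable_state hagg adv T).fst).sub_const _
  have h0 : 0 ≤ᵐ[runLaw m p ν] fun s : A × (ℕ → Round n m d) =>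
      honestLoss ℓ D H (state ℓ D H p adv s.1 s.2 T).1 - ⨅ θ, honestLoss ℓ D H θ :=
    .of_forall fun s => sub_iInf_nonneg hμ hsc _
  have hle : ∫⁻ s, ENNReal.ofReal (honestLoss ℓ D H (state ℓ D H p adv s.1 s.2 T).1
      - ⨅ θ, honestLoss ℓ D H θ) ∂(runLaw m p ν) ≤ ENNReal.ofReal ϱ := by
    refine (lintegral_mono fun s => ENNReal.ofReal_le_ofReal ?_).trans (h A ν adv)
    exact le_add_of_nonneg_right (by positivity)
  refine ⟨⟨hm.aestronglyMeasurable, ?_⟩, ?_⟩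
  · rw [hasFiniteIntegral_iff_ofReal h0]
    exact hle.trans_lt ENNReal.ofReal_lt_top
  · rw [integral_eq_lintegral_of_nonneg_ae h0 hm.aestronglyMeasurable]
    exact ENNReal.toReal_le_of_le_ofReal hϱ hle

theorem isRobust_of_subsingleton [Subsingleton (E d)] {p : Params n d} {T : ℕ} {ϱ : ℝ}
    (hϱ : 0 ≤ ϱ) : IsRobust ℓ D H p T ϱ := by
  intro A _ ν _ adv
  have h : ∀ θ : E d, honestLoss ℓ D H θ - ⨅ θ', honestLoss ℓ D H θ' = 0 := fun θ => by
    have : ∀ θ', honestLoss ℓ D H θ' = honestLoss ℓ D H θ := fun θ' => by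
      rw [Subsingleton.elim θ' θ]
    simp_rw [this, ciInf_const, sub_self]
  simp only [h]
  exact ⟨integrable_zero _ _ _, by simpa using hϱ⟩

end Robustness

end CafCor

end

theorem mainTheorem5 (η : ℝ) (hη : 0 < η) :
    ∃ K : ℝ, 0 < K ∧
      ∀ {X : Type*} (n m d f b : ℕ) (ℓ : CafCor.E d → X → ℝ) (D : Fin n → Fin m → X)
        (H : Finset (Fin n)) (θ₀ : CafCor.E d) (C ε δ L μ σ G : ℝ),
        1 ≤ n → (2 + η) * (f : ℝ) ≤ n → H.card = n - f →
        1 ≤ b → b ≤ m →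
        0 < C → 0 < ε → 0 < δ → δ < 1 → 0 < L → 0 < μ → 0 < σ → 0 < G →
        (∀ i ∈ H, ∀ j, Differentiable ℝ fun θ => ℓ θ (D i j)) →
        CafCor.BoundedHeterogeneity ℓ D H G →
        CafCor.BoundedVariance ℓ D H σ →
        CafCor.IsSmooth L (CafCor.honestLoss ℓ D H) →
        CafCor.IsStronglyConvex μ (CafCor.honestLoss ℓ D H) →
        ∃ T₀ : ℕ, ∀ T ≥ T₀,
          CafCor.IsRobust ℓ D H (CafCor.cwtmParams n d f b T C ε δ L μ θ₀) T
            (K * (L / μ ^ 2 * ((f : ℝ) / n * (C ^ 2 * d * Real.log (1 / δ) / ε ^ 2)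
                  + C ^ 2 * d * Real.log (1 / δ) / ((n : ℝ) ^ 2 * ε ^ 2))
                + 1 / μ * ((f : ℝ) / n * d * G ^ 2))) := by
  refine ⟨20000000 * ((2 + η) / η) ^ 2 + 20000000, by positivity, ?_⟩
  intro X n m d f b ℓ D H θ₀ C ε δ L μ σ G hn hratio hHc hb hbm hC hε hδ hδ1 hL hμ _ _ hd hG hσ
    hsm hsc
  have hlog : 0 < Real.log (1 / δ) := Real.log_pos ((one_lt_div hδ).2 hδ1)
  have hn0 : (0 : ℝ) < n := by exact_mod_cast hn
  -- In dimension `0` nothing forces `μ ≤ L`, on which the recursions rely, but there the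
  -- suboptimality is identically zero.
  rcases Nat.eq_zero_or_pos d with rfl | hd0
  · exact ⟨0, fun T _ => CafCor.isRobust_of_subsingleton (by positivity)⟩
  have : NeZero d := ⟨hd0.ne'⟩
  have hμL : μ ≤ L := CafCor.isStronglyConvex_le_isSmooth hsm hsc
  have hf : 2 * f < n := CafCor.two_mul_lt_of_ratio hη hn hratio
  have hκ0 := CafCor.trimCoeff_nonneg hf
  have hf' : (2 : ℝ) * f < n := by exact_mod_cast hf
  have hf0 : (0 : ℝ) ≤ f := f.cast_nonneg
  have hnf0 : (0 : ℝ) < n - f := by linarith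
  have hcard : (H.card : ℝ) = n - f := by rw [hHc, Nat.cast_sub (by omega)]
  have hd0' : (0 : ℝ) < d := by exact_mod_cast hd0
  set Q : ℝ := C ^ 2 * d * Real.log (1 / δ) / ε ^ 2 with hQ
  have hQ0 : 0 < Q := by positivity
  set κ := CafCor.trimCoeff n f with hκ
  -- Collects what does not grow with `T`: the initial gap and the `σ²` terms. All the rest of the
  -- numerator is proportional to `T` through the noise variance.
  set r : ℝ := 240 * (L / μ) * CafCor.lyapunov L (CafCor.honestLoss ℓ D H) θ₀ 0
    + L / μ ^ 2 * ((4800 * κ + 57600) * (2 * σ ^ 2)) with hr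
  have hr0 : 0 ≤ r := by
    have := CafCor.lyapunov_nonneg hL hμ hsc θ₀ 0
    positivity
  set τ : ℝ := L / μ ^ 2 * (Q / n ^ 2) with hτ
  have hτ0 : 0 < τ := by positivity
  set s : ℝ := 32 * Q / ((n : ℝ) - f) with hs
  have hs0 : 0 ≤ s := by positivity
  -- From this `T` on, `r / T ≤ τ`, and `τ` is itself a term of the rate; the extra `1` ensures `T ≥
  -- 1`. The choice precedes the adversary.
  refine ⟨⌈r / τ⌉₊ + 1, fun T hT => ?_⟩
  have hT1 : (1 : ℝ) ≤ T := by exact_mod_cast (Nat.le_add_left 1 _).trans hT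
  have hTr : r / T ≤ τ := by
    have h1 : r / τ ≤ T := (Nat.le_ceil _).trans (by exact_mod_cast (Nat.le_succ _).trans hT)
    rw [div_le_iff₀ hτ0] at h1
    rw [div_le_iff₀ (by positivity)]
    linarith
  have hbound := CafCor.asymptotic_bound_le hη hn hratio hL hμ hQ0.le
    (by positivity : 0 ≤ (d : ℝ) * G ^ 2) hs hTr
  rw [show C ^ 2 * d * Real.log (1 / δ) / ((n : ℝ) ^ 2 * ε ^ 2) = Q / n ^ 2 by
    rw [hQ]; field_simp, mul_assoc ((f : ℝ) / n) (d : ℝ)]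
  refine CafCor.isRobust_of_lintegral_le (CafCor.measurable_cwtm f) hd hL hμ hsc (by positivity)
    fun A _ ν _ adv => (CafCor.lintegral_lyapunov_le hf hHc hb hbm hδ hδ1 hL hμ hμL hd hG hσ hsm
      hsc T adv ν T).trans (ENNReal.ofReal_le_ofReal (le_trans ?_ hbound))
  have hvar : CafCor.noiseVar n f T C ε δ * d = T * s := by
    rw [CafCor.noiseVar, hs, hQ]; field_simp
  rw [hvar, hcard, ← hκ, show (n : ℝ) - (n - f) + 1 = f + 1 by ring, add_assoc]
  refine add_le_add le_rfl ?_
  have e : (240 * (L / μ) * CafCor.lyapunov L (CafCor.honestLoss ℓ D H) θ₀ 0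
      + L / μ ^ 2 * (4800 * κ * (2 * σ ^ 2 + 2 * (n * (T * s)))
        + 57600 * (2 * σ ^ 2 + 2 * (((f : ℝ) + 1) / (n - f) * (T * s)))))
      = r + T * (L / μ ^ 2 * (9600 * κ * (n * s)
        + 115200 * (((f : ℝ) + 1) / (n - f) * s))) := by
    rw [hr]; ring
  rw [e]
  have hx : 0 ≤ L / μ ^ 2 * (9600 * κ * (n * s)
      + 115200 * (((f : ℝ) + 1) / (n - f) * s)) := by positivity
  calc (r + T * (L / μ ^ 2 * (9600 * κ * (n * s)
        + 115200 * (((f : ℝ) + 1) / (n - f) * s)))) / (T + 240 * (L / μ))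
      ≤ (r + T * (L / μ ^ 2 * (9600 * κ * (n * s)
        + 115200 * (((f : ℝ) + 1) / (n - f) * s)))) / T := by
        refine div_le_div_of_nonneg_left (by positivity) (by positivity) ?_
        have : 0 ≤ 240 * (L / μ) := by positivity
        linarith
    _ = _ := by
        have : (T : ℝ) ≠ 0 := by positivity
        rw [add_div, mul_div_cancel_left₀ _ this]
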